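/- Let $L$ be a completely regular frame, with pseudocomplement $a\mapsto a^{\ast}$. Let $\overline{\mathrm{IC}}(L)$ be the set of frame homomorphisms $f\colon\mathfrak{L}(\overline{\mathbb{IR}})\to L$, where $\mathfrak{L}(\overline{\mathbb{IR}})$ is the frame generated by the symbols $(p,-)$ and $(-,q)$, $p,q\in\mathbb{Q}$, subject to the relations (r1) $(p,-)\wedge(-,q)=0$ if $p\ge q$, (r3) $(p,-)=\bigvee_{r>p}(r,-)$, (r4) $(-,q)=\bigvee_{s<q}(-,s)$. Order $\overline{\mathrm{IC}}(L)$ by: $f\le g$ iff $f(p,-)\le g(p,-)$ and $g(-,q)\le f(-,q)$ for all $p,q\in\mathbb{Q}$. Consider the following subsets. * $\overline{\mathrm{C}}(L)$ consists of the $f$ with (r2) $f(p,-)\vee f(-,q)=1$ for all $p<q$. * $\mathrm{C}(L)$ consists of the $f\in\overline{\mathrm{C}}(L)$ with $\bigvee_p f(p,-)=1=\bigvee_q f(-,q)$ (the continuous real functions on $L$). * $\overline{\mathrm{H}}(L)$ consists of the Hausdorff continuous $f$, that is, $f(p,-)^{\ast}\le f(-,q)$ and $f(-,q)^{\ast}\le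 f(p,-)$ for all $p<q$. * $\mathrm{H}_{nf}(L)$ consists of the nearly finite $f\in\overline{\mathrm{H}}(L)$, that is, $\bigl(\bigvee_p f(p,-)\bigr)^{\ast}=0=\bigl(\bigvee_q f(-,q)\bigr)^{\ast}$. For every frame $M$, $\mathrm{C}(M)$ is a Riesz space with its usual operations, which are determined by $(f\diamond g)(p,-)=\bigvee\{f(r,s)\wedge g(t,u)\mid x\diamond y>p\text{ for all }x\in(r,s),\,y\in(t,u)\}$ for $\diamond=+,\vee,\wedge$, where $f(r,s)=f(r,-)\wedge f(-,s)$, and by $(\lambda f)(p,-)=\bigvee\{f(r,s)\mid \lambda x>p\text{ for all }x\in(r,s)\}$ for $\lambda\in\mathbb{R}$; here $r,s,t,u\in\mathbb{Q}$. Let $\mathfrak{B}(L)=\{a\in L\mid a=a^{\ast\ast}\}$ be the Booleanization of $L$ and $\beta\colon L\to\mathfrak{B}(L)$, $\beta(a)=a^{\ast\ast}$. 1. The map $\Gamma(f)=\beta\circ f$ is an order isomorphism $\overline{\mathrm{H}}(L)\to\overline{\mathrm{C}}(\mathfrak{B}(L))$, with inverse $\Delta$ given by $\Delta(g)(p,-)=\bigvee^{L}_{r>p}g(r,-)$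 and $\Delta(g)(-,q)=\bigvee^{L}_{s<q}g(-,s)$. A function $f\in\overline{\mathrm{H}}(L)$ is nearly finite if and only if $\Gamma(f)\in\mathrm{C}(\mathfrak{B}(L))$. So $\Gamma$ restricts to a bijection $\mathrm{H}_{nf}(L)\to\mathrm{C}(\mathfrak{B}(L))$, which is an isomorphism of Riesz spaces when $\mathrm{H}_{nf}(L)$ carries the operations $f\oplus g=\Delta(\Gamma(f)+\Gamma(g))$, $\lambda\odot f=\Delta(\lambda\,\Gamma(f))$ and the order of $\overline{\mathrm{IC}}(L)$. 2. $\mathrm{H}_{nf}(L)$, with the inclusion $\mu\colon\mathrm{C}(L)\hookrightarrow\mathrm{H}_{nf}(L)$, is the universal completion of $\mathrm{C}(L)$. That is: $\mu$ is an injective linear lattice homomorphism; every non-empty subset of $\mathrm{H}_{nf}(L)$ that is bounded above has a supremum; every non-empty set of positive, pairwise disjoint elements of $\mathrm{H}_{nf}(L)$ has a supremum; and $f=\bigvee\{\mu(g)\mid g\in\mathrm{C}(L),\ 0\le\mu(g)\le f\}$ for every $0\le f\in\mathrm{H}_{nf}(L)$. -/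

import Mathlib

/-! ### Frames presented by generators and relations -/

namespace Pointfree

/-- The free frame on `G`: down-sets of the free meet-semilattice with top on `G`, which is
`Finset G` ordered by reverse inclusion. -/
abbrev FreeFrame (G : Type) : Type := LowerSet (Finset G)ᵒᵈ

namespace FreeFrame

/-- The generator of the free frame that corresponds to `g`. -/
def gen {G : Type} (g : G) : FreeFrame G := LowerSet.Iic (OrderDual.toDual {g})

theorem mem_gen {G : Type} (g : G) (F : Finset G) :
    OrderDual.toDual F ∈ gen g ↔ g ∈ F := by
  simp [gen]

open Classical in
/-- The frame homomorphism from the free frame that extends a map on generators. -/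
noncomputable def lift {G : Type} {L : Type*} [Order.Frame L] (φ : G → L) :
    FrameHom (FreeFrame G) L where
  toFun S := ⨆ F : Finset G, ⨆ _ : OrderDual.toDual F ∈ S, F.inf φ
  map_inf' S T := by
    apply le_antisymm
    · refine iSup₂_le fun F hF => le_inf ?_ ?_
      · exact le_iSup₂_of_le F hF.1 le_rfl
      · exact le_iSup₂_of_le F hF.2 le_rfl
    · simp only [iSup_inf_eq, inf_iSup_eq]
      refine iSup₂_le fun F' hF' => iSup₂_le fun F hF => ?_
      refine le_iSup₂_of_le (F ∪ F') ⟨?_, ?_⟩ (by rw [Finset.inf_union])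
      · exact S.lower (show OrderDual.toDual (F ∪ F') ≤ OrderDual.toDual F from
          Finset.subset_union_left) hF
      · exact T.lower (show OrderDual.toDual (F ∪ F') ≤ OrderDual.toDual F' from
          Finset.subset_union_right) hF'
  map_top' := top_le_iff.1 (le_iSup₂_of_le (∅ : Finset G) trivial (by simp))
  map_sSup' s := by
    apply le_antisymm
    · refine iSup₂_le fun F hF => ?_
      obtain ⟨S, hS, hFS⟩ := LowerSet.mem_sSup_iff.1 hF
      exact le_sSup_of_le ⟨S, hS, rfl⟩ (le_iSup₂_of_le F hFS le_rfl)
    · refine sSup_le ?_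
      rintro _ ⟨S, hS, rfl⟩
      exact iSup₂_le fun F hF => le_iSup₂_of_le F (LowerSet.mem_sSup_iff.2 ⟨S, hS, hF⟩) le_rfl

theorem lift_gen {G : Type} {L : Type*} [Order.Frame L] (φ : G → L) (g : G) :
    lift φ (gen g) = φ g := by
  apply le_antisymm
  · exact iSup₂_le fun F hF => Finset.inf_le ((mem_gen g F).1 hF)
  · exact le_iSup₂_of_le {g} ((mem_gen g {g}).2 (by simp)) (by simp)

theorem eq_iSup {G : Type} (S : FreeFrame G) :
    S = ⨆ F : Finset G, ⨆ _ : OrderDual.toDual F ∈ S, F.inf gen := by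
  ext A
  induction A using OrderDual.rec with | _ A =>
  have key : ∀ F : Finset G, OrderDual.toDual A ∈ F.inf gen ↔ F ⊆ A := by
    classical
    intro F
    induction F using Finset.induction_on with
    | empty => simp
    | insert a F _ ih =>
      rw [Finset.inf_insert, LowerSet.mem_inf_iff, ih, mem_gen, Finset.insert_subset_iff]
  change OrderDual.toDual A ∈ S ↔ OrderDual.toDual A ∈ (⨆ F : Finset G, ⨆ _ : OrderDual.toDual F ∈ S, F.inf gen)
  rw [LowerSet.mem_iSup_iff]
  simp only [LowerSet.mem_iSup_iff, key, exists_prop]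
  constructor
  · exact fun h => ⟨A, h, subset_rfl⟩
  · rintro ⟨F, hF, hFA⟩
    exact S.lower (show OrderDual.toDual A ≤ OrderDual.toDual F from hFA) hF

theorem hom_ext {G : Type} {L : Type*} [Order.Frame L] {h k : FrameHom (FreeFrame G) L}
    (H : ∀ g, h (gen g) = k (gen g)) : h = k := by
  ext S
  rw [eq_iSup S]
  have : h ∘ gen = k ∘ gen := funext H
  simp only [map_iSup, map_finset_inf, this]

end FreeFrame

/-- The least nucleus on the free frame that identifies the two sides of every relation. -/
def relNucleus {G : Type} (R : Set (FreeFrame G × FreeFrame G)) : Nucleus (FreeFrame G) :=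
  sInf {n | ∀ x ∈ R, n x.1 = n x.2}

/-- The frame presented by the generators `G` and the relations `R`: the quotient of the free
frame by the least nucleus that identifies the two sides of every relation. -/
def PresentedFrame {G : Type} (R : Set (FreeFrame G × FreeFrame G)) : Type :=
  Set.range (relNucleus R)

instance {G : Type} (R : Set (FreeFrame G × FreeFrame G)) : Order.Frame (PresentedFrame R) :=
  inferInstanceAs (Order.Frame (Set.range (relNucleus R)))

namespace PresentedFrame

variable {G : Type} {R : Set (FreeFrame G × FreeFrame G)} {L : Type*} [Order.Frame L]

/-- The quotient map from the free frame. -/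
def mk (R : Set (FreeFrame G × FreeFrame G)) : FrameHom (FreeFrame G) (PresentedFrame R) :=
  (relNucleus R).restrict

/-- The generators of the presented frame. -/
def of (R : Set (FreeFrame G × FreeFrame G)) (g : G) : PresentedFrame R :=
  mk R (FreeFrame.gen g)

theorem mk_surjective : Function.Surjective (mk R) := by
  rintro ⟨_, a, rfl⟩
  exact ⟨a, rfl⟩

theorem mk_eq {x : FreeFrame G × FreeFrame G} (hx : x ∈ R) : mk R x.1 = mk R x.2 := by
  apply Subtype.ext
  change relNucleus R x.1 = relNucleus R x.2
  simp only [relNucleus, Nucleus.sInf_apply]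
  exact iInf_congr fun n => iInf_congr fun hn => hn x hx

/-- The nucleus induced by a frame homomorphism. -/
def kerNucleus {F : Type*} [Order.Frame F] (h : FrameHom F L) : Nucleus F where
  toFun a := sSup {b | h b ≤ h a}
  map_inf' a b := by
    have hs : ∀ a, h (sSup {b | h b ≤ h a}) ≤ h a := fun a => by
      rw [map_sSup]; exact sSup_le (by rintro _ ⟨b, hb, rfl⟩; exact hb)
    apply le_antisymm
    · refine sSup_le fun c hc => le_inf (le_sSup ?_) (le_sSup ?_)
      · exact (hc : h c ≤ h (a ⊓ b)).trans (by rw [map_inf]; exact inf_le_left)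
      · exact (hc : h c ≤ h (a ⊓ b)).trans (by rw [map_inf]; exact inf_le_right)
    · refine le_sSup ?_
      change h _ ≤ h _
      rw [map_inf, map_inf]
      exact inf_le_inf (hs a) (hs b)
  idempotent' a := by
    have hs : ∀ a, h (sSup {b | h b ≤ h a}) ≤ h a := fun a => by
      rw [map_sSup]; exact sSup_le (by rintro _ ⟨b, hb, rfl⟩; exact hb)
    exact sSup_le fun c hc => le_sSup ((hc : h c ≤ _).trans (hs a))
  le_apply' a := le_sSup le_rfl

theorem map_relNucleus (h : FrameHom (FreeFrame G) L) (hR : ∀ x ∈ R, h x.1 = h x.2)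
    (a : FreeFrame G) : h (relNucleus R a) = h a := by
  apply le_antisymm
  · have h1 : relNucleus R ≤ kerNucleus h := sInf_le fun x hx => by
      change sSup {b | h b ≤ h x.1} = sSup {b | h b ≤ h x.2}
      rw [hR x hx]
    have h2 : relNucleus R a ≤ sSup {b | h b ≤ h a} := h1 a
    refine (OrderHomClass.mono h h2).trans ?_
    rw [map_sSup]
    exact sSup_le (by rintro _ ⟨b, hb, rfl⟩; exact hb)
  · exact OrderHomClass.mono h (Nucleus.le_apply)

/-- The universal property of the presented frame: a map on generators that turns the relations
into identities extends to a frame homomorphism. -/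
noncomputable def lift (R : Set (FreeFrame G × FreeFrame G)) (φ : G → L)
    (hR : ∀ x ∈ R, FreeFrame.lift φ x.1 = FreeFrame.lift φ x.2) :
    FrameHom (PresentedFrame R) L where
  toFun x := FreeFrame.lift φ x.1
  map_inf' x y := by
    obtain ⟨a, rfl⟩ := mk_surjective x
    obtain ⟨b, rfl⟩ := mk_surjective y
    rw [← map_inf]
    change FreeFrame.lift φ (relNucleus R _) =
      FreeFrame.lift φ (relNucleus R _) ⊓ FreeFrame.lift φ (relNucleus R _)
    simp only [map_relNucleus _ hR, map_inf]
  map_top' := by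
    rw [← map_top (mk R)]
    change FreeFrame.lift φ (relNucleus R _) = _
    rw [map_relNucleus _ hR, map_top]
  map_sSup' s := by
    have h1 : s = mk R '' (mk R ⁻¹' s) := (Set.image_preimage_eq s mk_surjective).symm
    rw [h1, ← map_sSup, Set.image_image]
    change FreeFrame.lift φ (relNucleus R _) = sSup ((fun a => FreeFrame.lift φ (relNucleus R a)) '' _)
    simp only [map_relNucleus _ hR, map_sSup]

theorem lift_of (φ : G → L) (hR : ∀ x ∈ R, FreeFrame.lift φ x.1 = FreeFrame.lift φ x.2) (g : G) :
    lift R φ hR (of R g) = φ g :=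
  (map_relNucleus _ hR _).trans (FreeFrame.lift_gen φ g)

theorem hom_ext {h k : FrameHom (PresentedFrame R) L} (H : ∀ g, h (of R g) = k (of R g)) :
    h = k := by
  have h1 : h.comp (mk R) = k.comp (mk R) := FreeFrame.hom_ext H
  ext x
  obtain ⟨a, rfl⟩ := mk_surjective x
  exact DFunLike.congr_fun h1 a

theorem respects (h : FrameHom (PresentedFrame R) L) {x : FreeFrame G × FreeFrame G}
    (hx : x ∈ R) :
    FreeFrame.lift (fun g => h (of R g)) x.1 = FreeFrame.lift (fun g => h (of R g)) x.2 := by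
  have h1 : FreeFrame.lift (fun g => h (of R g)) = h.comp (mk R) :=
    FreeFrame.hom_ext fun g => FreeFrame.lift_gen _ g
  rw [h1, FrameHom.comp_apply, FrameHom.comp_apply, mk_eq hx]

end PresentedFrame

/-! ### The frames of reals, of extended reals and of extended partial reals -/

/-- The generators `(p,—)` (written `above p`) and `(—,q)` (written `below q`). -/
inductive RealGen : Type
  | above (p : ℚ) : RealGen
  | below (q : ℚ) : RealGen

/-- The generator `(p,—)` in the free frame. -/
def gAbove (p : ℚ) : FreeFrame RealGen := FreeFrame.gen (RealGen.above p)

/-- The generator `(—,q)` in the free frame. -/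
def gBelow (q : ℚ) : FreeFrame RealGen := FreeFrame.gen (RealGen.below q)

/-- (r1): `(p,—) ∧ (—,q) = 0` whenever `p ≥ q`. -/
def rel1 : Set (FreeFrame RealGen × FreeFrame RealGen) :=
  {x | ∃ p q : ℚ, q ≤ p ∧ x = (gAbove p ⊓ gBelow q, ⊥)}

/-- (r2): `(p,—) ∨ (—,q) = 1` whenever `p < q`. -/
def rel2 : Set (FreeFrame RealGen × FreeFrame RealGen) :=
  {x | ∃ p q : ℚ, p < q ∧ x = (gAbove p ⊔ gBelow q, ⊤)}

/-- (r3): `(p,—) = ⋁_{r > p} (r,—)`. -/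
def rel3 : Set (FreeFrame RealGen × FreeFrame RealGen) :=
  {x | ∃ p : ℚ, x = (gAbove p, ⨆ r : ℚ, ⨆ _ : p < r, gAbove r)}

/-- (r4): `(—,q) = ⋁_{s < q} (—,s)`. -/
def rel4 : Set (FreeFrame RealGen × FreeFrame RealGen) :=
  {x | ∃ q : ℚ, x = (gBelow q, ⨆ s : ℚ, ⨆ _ : s < q, gBelow s)}

/-- (r5): `⋁_p (p,—) = 1`. -/
def rel5 : Set (FreeFrame RealGen × FreeFrame RealGen) :=
  {(⨆ p : ℚ, gAbove p, ⊤)}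

/-- (r6): `⋁_q (—,q) = 1`. -/
def rel6 : Set (FreeFrame RealGen × FreeFrame RealGen) :=
  {(⨆ q : ℚ, gBelow q, ⊤)}

/-- The frame of reals `𝔏(ℝ)`. -/
abbrev FrameOfReals : Type :=
  PresentedFrame (rel1 ∪ rel2 ∪ rel3 ∪ rel4 ∪ rel5 ∪ rel6)

/-- The frame of extended reals: (r5) and (r6) are dropped. -/
abbrev FrameOfExtReals : Type := PresentedFrame (rel1 ∪ rel2 ∪ rel3 ∪ rel4)

/-- The frame of extended partial reals: (r2), (r5) and (r6) are dropped. -/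
abbrev FrameOfExtPartialReals : Type := PresentedFrame (rel1 ∪ rel3 ∪ rel4)

/-- The continuous extended partial real functions on a frame `L`: the frame homomorphisms from
the frame of extended partial reals to `L`. -/
def ICbar (L : Type*) [Order.Frame L] : Type _ := FrameHom FrameOfExtPartialReals L

namespace ICbar

variable {L : Type*} [Order.Frame L]

/-- `f(p,—)` -/
def above (f : ICbar L) (p : ℚ) : L :=
  (show FrameHom FrameOfExtPartialReals L from f) (PresentedFrame.of _ (RealGen.above p))

/-- `f(—,q)` -/
def below (f : ICbar L) (q : ℚ) : L :=
  (show FrameHom FrameOfExtPartialReals L from f) (PresentedFrame.of _ (RealGen.below q))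

/-- The composite `h · f` with a frame homomorphism `h : L → M`. -/
def postcomp {M : Type*} [Order.Frame M] (h : FrameHom L M) (f : ICbar L) : ICbar M :=
  FrameHom.comp h (show FrameHom FrameOfExtPartialReals L from f)

@[simp] theorem postcomp_above {M : Type*} [Order.Frame M] (h : FrameHom L M) (f : ICbar L)
    (p : ℚ) : (postcomp h f).above p = h (f.above p) := rfl

@[simp] theorem postcomp_below {M : Type*} [Order.Frame M] (h : FrameHom L M) (f : ICbar L)
    (q : ℚ) : (postcomp h f).below q = h (f.below q) := rfl

@[ext] theorem ext {f g : ICbar L} (h1 : ∀ p, f.above p = g.above p)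
    (h2 : ∀ q, f.below q = g.below q) : f = g :=
  PresentedFrame.hom_ext (by rintro (p | q); exacts [h1 p, h2 q])

/-- `f ≤ g` iff `f(p,—) ≤ g(p,—)` and `g(—,q) ≤ f(—,q)` for all `p`, `q`. -/
instance : PartialOrder (ICbar L) where
  le f g := (∀ p, f.above p ≤ g.above p) ∧ ∀ q, g.below q ≤ f.below q
  le_refl _ := ⟨fun _ => le_rfl, fun _ => le_rfl⟩
  le_trans _ _ _ h k := ⟨fun p => (h.1 p).trans (k.1 p), fun q => (k.2 q).trans (h.2 q)⟩
  le_antisymm _ _ h k :=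
    ext (fun p => (h.1 p).antisymm (k.1 p)) fun q => (k.2 q).antisymm (h.2 q)

theorem le_def {f g : ICbar L} :
    f ≤ g ↔ (∀ p, f.above p ≤ g.above p) ∧ ∀ q, g.below q ≤ f.below q := Iff.rfl

theorem above_inf_below (f : ICbar L) {p q : ℚ} (h : q ≤ p) : f.above p ⊓ f.below q = ⊥ := by
  have := PresentedFrame.respects (show FrameHom FrameOfExtPartialReals L from f)
    (Or.inl (Or.inl ⟨p, q, h, rfl⟩))
  simp only [gAbove, gBelow, map_inf, FreeFrame.lift_gen, map_bot] at this
  exact this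

theorem above_eq (f : ICbar L) (p : ℚ) : f.above p = ⨆ r : ℚ, ⨆ _ : p < r, f.above r := by
  have := PresentedFrame.respects (show FrameHom FrameOfExtPartialReals L from f)
    (Or.inl (Or.inr ⟨p, rfl⟩))
  simp only [gAbove, map_iSup, FreeFrame.lift_gen] at this
  exact this

theorem below_eq (f : ICbar L) (q : ℚ) : f.below q = ⨆ s : ℚ, ⨆ _ : s < q, f.below s := by
  have := PresentedFrame.respects (show FrameHom FrameOfExtPartialReals L from f)
    (Or.inr ⟨q, rfl⟩)
  simp only [gBelow, map_iSup, FreeFrame.lift_gen] at this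
  exact this

theorem above_anti (f : ICbar L) : Antitone f.above := fun p r h => by
  rcases h.eq_or_lt with rfl | h
  · exact le_rfl
  · rw [f.above_eq p]; exact le_iSup₂_of_le r h le_rfl

theorem below_mono (f : ICbar L) : Monotone f.below := fun p r h => by
  rcases h.eq_or_lt with rfl | h
  · exact le_rfl
  · rw [f.below_eq r]; exact le_iSup₂_of_le p h le_rfl

/-- The function determined by values on the generators that satisfy (r1), (r3) and (r4). -/
noncomputable def mk' (a b : ℚ → L) (h1 : ∀ p q, q ≤ p → a p ⊓ b q = ⊥)
    (h3 : ∀ p, a p = ⨆ r : ℚ, ⨆ _ : p < r, a r)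
    (h4 : ∀ q, b q = ⨆ s : ℚ, ⨆ _ : s < q, b s) : ICbar L :=
  PresentedFrame.lift _ (fun g => RealGen.casesOn g a b) (by
    rintro x ((⟨p, q, h, rfl⟩ | ⟨p, rfl⟩) | ⟨q, rfl⟩)
    · simpa only [gAbove, gBelow, map_inf, FreeFrame.lift_gen, map_bot] using h1 p q h
    · simpa only [gAbove, map_iSup, FreeFrame.lift_gen] using h3 p
    · simpa only [gBelow, map_iSup, FreeFrame.lift_gen] using h4 q)

@[simp] theorem mk'_above (a b : ℚ → L) (h1 h3 h4) (p : ℚ) :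
    (mk' a b h1 h3 h4).above p = a p := PresentedFrame.lift_of _ _ _

@[simp] theorem mk'_below (a b : ℚ → L) (h1 h3 h4) (q : ℚ) :
    (mk' a b h1 h3 h4).below q = b q := PresentedFrame.lift_of _ _ _

/-- `f` turns (r2) into an identity. -/
def IsExtReal (f : ICbar L) : Prop := ∀ p q : ℚ, p < q → f.above p ⊔ f.below q = ⊤

/-- `f` turns (r2), (r5) and (r6) into identities. -/
def IsReal (f : ICbar L) : Prop :=
  f.IsExtReal ∧ (⨆ p : ℚ, f.above p) = ⊤ ∧ (⨆ q : ℚ, f.below q) = ⊤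

/-- `f` is Hausdorff continuous. -/
def IsHausdorff (f : ICbar L) : Prop :=
  ∀ p q : ℚ, p < q → (f.above p)ᶜ ≤ f.below q ∧ (f.below q)ᶜ ≤ f.above p

/-- `⋁_p f(p,—)` and `⋁_q f(—,q)` are dense elements of `L`. -/
def IsNearlyFinite (f : ICbar L) : Prop :=
  (⨆ p : ℚ, f.above p)ᶜ = ⊥ ∧ (⨆ q : ℚ, f.below q)ᶜ = ⊥

end ICbar

/-- The basic homomorphism from the frame of extended partial reals to the frame of extended
reals. -/
noncomputable def toExtReals : FrameHom FrameOfExtPartialReals FrameOfExtReals :=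
  PresentedFrame.lift _ (PresentedFrame.of _) fun x hx => by
    have h : FreeFrame.lift (PresentedFrame.of (rel1 ∪ rel2 ∪ rel3 ∪ rel4)) =
        PresentedFrame.mk (rel1 ∪ rel2 ∪ rel3 ∪ rel4) :=
      FreeFrame.hom_ext (FreeFrame.lift_gen _)
    rw [h]
    refine PresentedFrame.mk_eq ?_
    rcases hx with (hx | hx) | hx <;> simp [hx]

/-- The basic homomorphism from the frame of extended partial reals to the frame of reals. -/
noncomputable def toReals : FrameHom FrameOfExtPartialReals FrameOfReals :=
  PresentedFrame.lift _ (PresentedFrame.of _) fun x hx => by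
    have h : FreeFrame.lift (PresentedFrame.of (rel1 ∪ rel2 ∪ rel3 ∪ rel4 ∪ rel5 ∪ rel6)) =
        PresentedFrame.mk (rel1 ∪ rel2 ∪ rel3 ∪ rel4 ∪ rel5 ∪ rel6) :=
      FreeFrame.hom_ext (FreeFrame.lift_gen _)
    rw [h]
    refine PresentedFrame.mk_eq ?_
    rcases hx with (hx | hx) | hx <;> simp [hx]

/-- The functions with (r2) are exactly the frame homomorphisms from the frame of extended reals,
through the basic homomorphism. -/
theorem ICbar.isExtReal_iff {L : Type*} [Order.Frame L] (f : ICbar L) :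
    f.IsExtReal ↔ ∃! g : FrameHom FrameOfExtReals L, f = g.comp toExtReals := by
  have hof : ∀ g, toExtReals (PresentedFrame.of _ g) = PresentedFrame.of _ g :=
    fun g => PresentedFrame.lift_of _ _ g
  constructor
  · intro h2
    refine ⟨PresentedFrame.lift _ (fun g => RealGen.casesOn g f.above f.below) ?_, ?_, ?_⟩
    · rintro x (((⟨p, q, h, rfl⟩ | ⟨p, q, h, rfl⟩) | ⟨p, rfl⟩) | ⟨q, rfl⟩)
      · simpa only [gAbove, gBelow, map_inf, FreeFrame.lift_gen, map_bot] using f.above_inf_below h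
      · simpa only [gAbove, gBelow, map_sup, FreeFrame.lift_gen, map_top] using h2 p q h
      · simpa only [gAbove, map_iSup, FreeFrame.lift_gen] using f.above_eq p
      · simpa only [gBelow, map_iSup, FreeFrame.lift_gen] using f.below_eq q
    · refine PresentedFrame.hom_ext fun g => ?_
      rw [FrameHom.comp_apply, hof, PresentedFrame.lift_of]
      cases g <;> rfl
    · rintro g rfl
      refine PresentedFrame.hom_ext fun x => ?_
      rw [PresentedFrame.lift_of]
      cases x <;> exact (congrArg g (hof _)).symm
  · rintro ⟨g, rfl, -⟩ p q h
    change g (toExtReals _) ⊔ g (toExtReals _) = ⊤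
    rw [hof, hof]
    have := PresentedFrame.respects g (Or.inl (Or.inl (Or.inr ⟨p, q, h, rfl⟩)))
    simpa only [gAbove, gBelow, map_sup, FreeFrame.lift_gen, map_top] using this

/-- The functions with (r2), (r5) and (r6) are exactly the frame homomorphisms from the frame of
reals, through the basic homomorphism. -/
theorem ICbar.isReal_iff {L : Type*} [Order.Frame L] (f : ICbar L) :
    f.IsReal ↔ ∃! g : FrameHom FrameOfReals L, f = g.comp toReals := by
  have hof : ∀ g, toReals (PresentedFrame.of _ g) = PresentedFrame.of _ g :=
    fun g => PresentedFrame.lift_of _ _ g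
  constructor
  · rintro ⟨h2, h5, h6⟩
    refine ⟨PresentedFrame.lift _ (fun g => RealGen.casesOn g f.above f.below) ?_, ?_, ?_⟩
    · rintro x (((((⟨p, q, h, rfl⟩ | ⟨p, q, h, rfl⟩) | ⟨p, rfl⟩) | ⟨q, rfl⟩) | rfl) | rfl)
      · simpa only [gAbove, gBelow, map_inf, FreeFrame.lift_gen, map_bot] using f.above_inf_below h
      · simpa only [gAbove, gBelow, map_sup, FreeFrame.lift_gen, map_top] using h2 p q h
      · simpa only [gAbove, map_iSup, FreeFrame.lift_gen] using f.above_eq p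
      · simpa only [gBelow, map_iSup, FreeFrame.lift_gen] using f.below_eq q
      · simpa only [gAbove, map_iSup, FreeFrame.lift_gen, map_top] using h5
      · simpa only [gBelow, map_iSup, FreeFrame.lift_gen, map_top] using h6
    · refine PresentedFrame.hom_ext fun g => ?_
      rw [FrameHom.comp_apply, hof, PresentedFrame.lift_of]
      cases g <;> rfl
    · rintro g rfl
      refine PresentedFrame.hom_ext fun x => ?_
      rw [PresentedFrame.lift_of]
      cases x <;> exact (congrArg g (hof _)).symm
  · rintro ⟨g, rfl, -⟩
    refine ⟨fun p q h => ?_, ?_, ?_⟩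
    · change g (toReals _) ⊔ g (toReals _) = ⊤
      rw [hof, hof]
      have := PresentedFrame.respects g (Or.inl (Or.inl (Or.inl (Or.inl (Or.inr ⟨p, q, h, rfl⟩)))))
      simpa only [gAbove, gBelow, map_sup, FreeFrame.lift_gen, map_top] using this
    · change (⨆ p, g (toReals _)) = ⊤
      simp only [hof]
      have := PresentedFrame.respects g (Or.inl (Or.inr rfl))
      simpa only [gAbove, map_iSup, FreeFrame.lift_gen, map_top] using this
    · change (⨆ p, g (toReals _)) = ⊤
      simp only [hof]
      have := PresentedFrame.respects g (Or.inr rfl)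
      simpa only [gBelow, map_iSup, FreeFrame.lift_gen, map_top] using this

/-- The extended continuous real functions on `L`, as a part of `ICbar L`. -/
def Cbar (L : Type*) [Order.Frame L] : Type _ := {f : ICbar L // f.IsExtReal}

/-- The continuous real functions on `L`, as a part of `ICbar L`. -/
def CReal (L : Type*) [Order.Frame L] : Type _ := {f : ICbar L // f.IsReal}

/-- The Hausdorff continuous extended partial real functions on `L`. -/
def Hbar (L : Type*) [Order.Frame L] : Type _ := {f : ICbar L // f.IsHausdorff}

/-- The nearly finite Hausdorff continuous functions on `L`. -/
def Hnf (L : Type*) [Order.Frame L] : Type _ :=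
  {f : ICbar L // f.IsHausdorff ∧ f.IsNearlyFinite}

instance (L : Type*) [Order.Frame L] : PartialOrder (Cbar L) :=
  inferInstanceAs (PartialOrder {f : ICbar L // f.IsExtReal})

instance (L : Type*) [Order.Frame L] : PartialOrder (Hbar L) :=
  inferInstanceAs (PartialOrder {f : ICbar L // f.IsHausdorff})

/-! ### The Riesz space of continuous real functions

For continuous real functions `f i` (`i` in a finite set `ι`) and a continuous
`φ : ℝ^ι → ℝ`, the continuous real function `φ(f)` has
`φ(f)(p,—) = ⋁ {⋀_i f_i(a_i,b_i) | φ > p on the box ∏_i (a_i,b_i)}`, the boxes having rational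
end points, and similarly for `φ(f)(—,q)`.  The operations of `C(L)` are the cases
`φ = x + y`, `x ∨ y`, `x ∧ y`, `-x`, `λ x`. -/

namespace CReal

variable {L : Type*} [Order.Frame L]

/-- `f(p,—)` -/
def above (f : CReal L) (p : ℚ) : L := f.1.above p

/-- `f(—,q)` -/
def below (f : CReal L) (q : ℚ) : L := f.1.below q

@[ext] theorem ext {f g : CReal L} (h1 : ∀ p, f.above p = g.above p)
    (h2 : ∀ q, f.below q = g.below q) : f = g :=
  Subtype.ext (ICbar.ext h1 h2)

theorem above_inf_below (f : CReal L) {p q : ℚ} (h : q ≤ p) : f.above p ⊓ f.below q = ⊥ :=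
  f.1.above_inf_below h

theorem above_sup_below (f : CReal L) {p q : ℚ} (h : p < q) : f.above p ⊔ f.below q = ⊤ :=
  f.2.1 p q h

theorem above_eq (f : CReal L) (p : ℚ) : f.above p = ⨆ r : ℚ, ⨆ _ : p < r, f.above r :=
  f.1.above_eq p

theorem below_eq (f : CReal L) (q : ℚ) : f.below q = ⨆ s : ℚ, ⨆ _ : s < q, f.below s :=
  f.1.below_eq q

theorem iSup_above (f : CReal L) : (⨆ p : ℚ, f.above p) = ⊤ := f.2.2.1

theorem iSup_below (f : CReal L) : (⨆ q : ℚ, f.below q) = ⊤ := f.2.2.2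

theorem above_anti (f : CReal L) : Antitone f.above := f.1.above_anti

theorem below_mono (f : CReal L) : Monotone f.below := f.1.below_mono

theorem above_inf_above (f : CReal L) (p q : ℚ) : f.above p ⊓ f.above q = f.above (max p q) := by
  rcases le_total p q with h | h
  · rw [max_eq_right h, inf_eq_right.2 (f.above_anti h)]
  · rw [max_eq_left h, inf_eq_left.2 (f.above_anti h)]

theorem below_inf_below (f : CReal L) (p q : ℚ) : f.below p ⊓ f.below q = f.below (min p q) := by
  rcases le_total p q with h | h
  · rw [min_eq_left h, inf_eq_left.2 (f.below_mono h)]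
  · rw [min_eq_right h, inf_eq_right.2 (f.below_mono h)]

/-- Small intervals cover. -/
theorem iSup_interval (f : CReal L) {ε : ℚ} (hε : 0 < ε) :
    (⨆ x : ℚ, f.above x ⊓ f.below (x + ε)) = ⊤ := by
  set S := ⨆ x : ℚ, f.above x ⊓ f.below (x + ε) with hS
  have key : ∀ (p : ℚ) (n : ℕ), f.above p ⊓ f.below (p + n * (ε / 2)) ≤ S := by
    intro p n
    induction n with
    | zero => simp [f.above_inf_below le_rfl]
    | succ n ih =>
      have h1 : f.above (p + n * (ε / 2) - ε / 2) ⊔ f.below (p + n * (ε / 2)) = ⊤ :=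
        f.above_sup_below (by linarith)
      calc f.above p ⊓ f.below (p + (n + 1 : ℕ) * (ε / 2))
          = (f.above p ⊓ f.below (p + (n + 1 : ℕ) * (ε / 2))) ⊓
              (f.above (p + n * (ε / 2) - ε / 2) ⊔ f.below (p + n * (ε / 2))) := by
            rw [h1, inf_top_eq]
        _ ≤ S := by
            rw [inf_sup_left]
            refine sup_le ?_ ?_
            · refine le_trans ?_ (le_iSup _ (p + n * (ε / 2) - ε / 2))
              refine le_inf inf_le_right ?_
              refine (inf_le_left.trans inf_le_right).trans (f.below_mono ?_)
              push_cast
              linarith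
            · exact le_trans (inf_le_inf_right _ inf_le_left) ih
  rw [eq_top_iff, ← inf_top_eq (⊤ : L)]
  nth_rewrite 1 [← f.iSup_above]
  rw [← f.iSup_below, iSup_inf_iSup]
  refine iSup_le fun ⟨p, q⟩ => ?_
  obtain ⟨n, hn⟩ := exists_nat_gt ((q - p) / (ε / 2))
  refine le_trans (inf_le_inf_left _ (f.below_mono ?_)) (key p n)
  rw [div_lt_iff₀ (by linarith)] at hn
  linarith

/-- The continuous real function determined by values on generators that satisfy (r1)--(r6). -/
noncomputable def mk' (a b : ℚ → L) (h1 : ∀ p q, q ≤ p → a p ⊓ b q = ⊥)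
    (h2 : ∀ p q, p < q → a p ⊔ b q = ⊤)
    (h3 : ∀ p, a p = ⨆ r : ℚ, ⨆ _ : p < r, a r)
    (h4 : ∀ q, b q = ⨆ s : ℚ, ⨆ _ : s < q, b s)
    (h5 : (⨆ p, a p) = ⊤) (h6 : (⨆ q, b q) = ⊤) : CReal L :=
  ⟨ICbar.mk' a b h1 h3 h4, by
    refine ⟨fun p q h => ?_, ?_, ?_⟩ <;> simp only [ICbar.mk'_above, ICbar.mk'_below]
    exacts [h2 p q h, h5, h6]⟩

@[simp] theorem mk'_above (a b : ℚ → L) (h1 h2 h3 h4 h5 h6) (p : ℚ) :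
    (mk' a b h1 h2 h3 h4 h5 h6).above p = a p := ICbar.mk'_above a b h1 h3 h4 p

@[simp] theorem mk'_below (a b : ℚ → L) (h1 h2 h3 h4 h5 h6) (q : ℚ) :
    (mk' a b h1 h2 h3 h4 h5 h6).below q = b q := ICbar.mk'_below a b h1 h3 h4 q

section Calculus

open TopologicalSpace

variable {ι : Type}

/-- The open box with the given rational end points. -/
def box (a b : ι → ℚ) : Set (ι → ℝ) := {x | ∀ i, (a i : ℝ) < x i ∧ x i < b i}

/-- `⋀_i f_i(a_i,b_i)` -/
def boxVal (f : ι → CReal L) (a b : ι → ℚ) : L := ⨅ i, (f i).above (a i) ⊓ (f i).below (b i)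

theorem boxVal_inf (f : ι → CReal L) (a b a' b' : ι → ℚ) :
    boxVal f a b ⊓ boxVal f a' b' = boxVal f (a ⊔ a') (b ⊓ b') := by
  rw [boxVal, boxVal, boxVal, ← iInf_inf_eq]
  refine iInf_congr fun i => ?_
  rw [inf_inf_inf_comm, above_inf_above, below_inf_below]
  rfl

theorem boxVal_eq_bot (f : ι → CReal L) {a b : ι → ℚ} {i : ι} (h : b i ≤ a i) :
    boxVal f a b = ⊥ :=
  le_bot_iff.1 ((iInf_le _ i).trans ((f i).above_inf_below h).le)

theorem iSup_boxVal [Fintype ι] (f : ι → CReal L) {ε : ℚ} (hε : 0 < ε) :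
    (⨆ x : ι → ℚ, boxVal f x (fun i => x i + ε)) = ⊤ := by
  simp only [boxVal]
  rw [← iInf_iSup_eq_of_finite (f := fun i (x : ℚ) => (f i).above x ⊓ (f i).below (x + ε))]
  simp only [iSup_interval _ hε, iInf_top]

/-- The join of the `⋀_i f_i(a_i,b_i)` over all rational boxes that are contained in `O`. -/
def openVal (f : ι → CReal L) (O : Opens (ι → ℝ)) : L :=
  ⨆ a : ι → ℚ, ⨆ b : ι → ℚ, ⨆ _ : box a b ⊆ (O : Set (ι → ℝ)), boxVal f a b

theorem le_openVal (f : ι → CReal L) {O : Opens (ι → ℝ)} {a b : ι → ℚ}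
    (h : box a b ⊆ (O : Set (ι → ℝ))) : boxVal f a b ≤ openVal f O :=
  le_iSup_of_le a (le_iSup₂_of_le b h le_rfl)

theorem openVal_le (f : ι → CReal L) {O : Opens (ι → ℝ)} {x : L}
    (h : ∀ a b : ι → ℚ, box a b ⊆ (O : Set (ι → ℝ)) → boxVal f a b ≤ x) : openVal f O ≤ x :=
  iSup_le fun a => iSup₂_le fun b hab => h a b hab

theorem openVal_mono (f : ι → CReal L) : Monotone (openVal f) := fun _ _ h =>
  openVal_le f fun _ _ hab => le_openVal f (hab.trans h)

theorem boxVal_le_of_cover [Fintype ι] (f : ι → CReal L) (s : Set (Opens (ι → ℝ))) {a b : ι → ℚ}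
    (h : box a b ⊆ ((sSup s : Opens (ι → ℝ)) : Set (ι → ℝ))) :
    boxVal f a b ≤ sSup (openVal f '' s) := by
  have h1 : boxVal f a b = ⨆ g : ∀ i, {x : ℚ × ℚ // a i < x.1 ∧ x.2 < b i},
      boxVal f (fun i => (g i).1.1) (fun i => (g i).1.2) := by
    simp only [boxVal]
    rw [← iInf_iSup_eq_of_finite
      (f := fun i (x : {x : ℚ × ℚ // a i < x.1 ∧ x.2 < b i}) =>
        (f i).above x.1.1 ⊓ (f i).below x.1.2)]
    refine iInf_congr fun i => ?_
    apply le_antisymm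
    · rw [above_eq, below_eq]
      simp only [iSup_inf_eq, inf_iSup_eq]
      exact iSup₂_le fun r hr => iSup₂_le fun r' hr' =>
        le_iSup_of_le ⟨(r', r), by exact ⟨hr', hr⟩⟩ le_rfl
    · exact iSup_le fun x => inf_le_inf ((f i).above_anti x.2.1.le) ((f i).below_mono x.2.2.le)
  rw [h1]
  refine iSup_le fun g => ?_
  set r : ι → ℚ := fun i => (g i).1.1 with hr
  set t : ι → ℚ := fun i => (g i).1.2 with ht
  have hK : IsCompact (Set.Icc (fun i => (r i : ℝ)) (fun i => (t i : ℝ))) := isCompact_Icc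
  obtain ⟨δ, hδ, hball⟩ := lebesgue_number_lemma_of_metric_sUnion hK
    (c := (fun O : Opens (ι → ℝ) => (O : Set (ι → ℝ))) '' s)
    (by rintro _ ⟨O, _, rfl⟩; exact O.isOpen) (by
      intro x hx
      have hx' : x ∈ box a b := fun i =>
        ⟨lt_of_lt_of_le (Rat.cast_lt.2 (g i).2.1) (hx.1 i),
          lt_of_le_of_lt (hx.2 i) (Rat.cast_lt.2 (g i).2.2)⟩
      have := h hx'
      rw [Set.sUnion_image]
      simpa using this)
  obtain ⟨ε, hε0, hεδ⟩ := exists_rat_btwn hδ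
  have hε : 0 < ε := by exact_mod_cast hε0
  rw [← inf_top_eq (boxVal f r t), ← iSup_boxVal f hε, inf_iSup_eq]
  refine iSup_le fun x => ?_
  rw [boxVal_inf]
  by_cases hne : ∀ i, (r ⊔ x) i < (t ⊓ fun i => x i + ε) i
  · obtain ⟨_, ⟨O, hO, rfl⟩, hsub⟩ := hball (fun i => (((r ⊔ x) i : ℚ) : ℝ)) (by
      constructor
      · intro i
        have : r i ≤ (r ⊔ x) i := le_sup_left
        exact Rat.cast_le.2 this
      · intro i
        have : (r ⊔ x) i ≤ t i := (hne i).le.trans inf_le_left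
        exact Rat.cast_le.2 this)
    refine le_trans (le_openVal f (O := O) ?_) (le_sSup ⟨O, hO, rfl⟩)
    refine subset_trans ?_ hsub
    intro z hz
    rw [Metric.mem_ball, dist_pi_lt_iff hδ]
    intro i
    have h2 := hz i
    have h3 : (t ⊓ fun i => x i + ε) i ≤ x i + ε := inf_le_right
    have h4 : x i ≤ (r ⊔ x) i := le_sup_right
    have h3' : (((t ⊓ fun i => x i + ε) i : ℚ) : ℝ) ≤ x i + ε := by exact_mod_cast h3
    have h4' : (x i : ℝ) ≤ (((r ⊔ x) i : ℚ) : ℝ) := by exact_mod_cast h4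
    rw [Real.dist_eq, abs_lt]
    constructor <;> linarith [h2.1, h2.2]
  · push Not at hne
    obtain ⟨i, hi⟩ := hne
    rw [boxVal_eq_bot f hi]
    exact bot_le

theorem box_nonempty {a b : ι → ℚ} (h : ∀ i, a i < b i) (i : ι) (c : ℚ) (hc : a i < c)
    (hc' : c < b i) : ∃ x ∈ box a b, x i = c := by
  classical
  refine ⟨Function.update (fun j => ((a j : ℝ) + b j) / 2) i c, fun j => ?_, by simp⟩
  by_cases hj : j = i
  · subst hj
    simp only [Function.update_self]
    exact ⟨by exact_mod_cast hc, by exact_mod_cast hc'⟩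
  · have := h j
    have : (a j : ℝ) < b j := by exact_mod_cast this
    simp only [Function.update_of_ne hj]
    constructor <;> linarith

variable [Fintype ι]

/-- The frame homomorphism from the opens of `ℝ^ι` that is determined by the `f i`. -/
def openHom (f : ι → CReal L) : FrameHom (Opens (ι → ℝ)) L where
  toFun := openVal f
  map_inf' O O' := by
    apply le_antisymm
    · exact le_inf (openVal_mono f inf_le_left) (openVal_mono f inf_le_right)
    · simp only [openVal, iSup_inf_eq, inf_iSup_eq]
      refine iSup_le fun a => iSup₂_le fun b hab => iSup_le fun a' => iSup₂_le fun b' hab' => ?_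
      rw [boxVal_inf]
      refine le_openVal f fun x hx => ?_
      have hx1 : ∀ i, (a' i : ℝ) < x i ∧ (a i : ℝ) < x i := fun i => by
        have := (hx i).1
        simpa [Pi.sup_apply] using this
      have hx2 : ∀ i, x i < b' i ∧ x i < b i := fun i => by
        have := (hx i).2
        simpa [Pi.inf_apply] using this
      exact ⟨hab' fun i => ⟨(hx1 i).1, (hx2 i).1⟩, hab fun i => ⟨(hx1 i).2, (hx2 i).2⟩⟩
  map_top' := by
    rw [eq_top_iff, ← iSup_boxVal f one_pos]
    exact iSup_le fun x => le_openVal f fun _ _ => trivial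
  map_sSup' s := by
    apply le_antisymm
    · exact openVal_le f fun a b hab => boxVal_le_of_cover f s hab
    · refine sSup_le ?_
      rintro _ ⟨O, hO, rfl⟩
      exact openVal_mono f (le_sSup hO)

/-- The open half space `{x | p < φ x}`. -/
def opensGt (φ : C(ι → ℝ, ℝ)) (p : ℝ) : Opens (ι → ℝ) :=
  ⟨{x | p < φ x}, isOpen_lt continuous_const φ.continuous⟩

/-- The open half space `{x | φ x < q}`. -/
def opensLt (φ : C(ι → ℝ, ℝ)) (q : ℝ) : Opens (ι → ℝ) :=
  ⟨{x | φ x < q}, isOpen_lt φ.continuous continuous_const⟩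

/-- The `i`-th coordinate. -/
def coord (i : ι) : C(ι → ℝ, ℝ) := ⟨fun x => x i, continuous_apply i⟩

theorem openHom_gt (f : ι → CReal L) (i : ι) (p : ℚ) :
    openHom f (opensGt (coord i) p) = (f i).above p := by
  classical
  apply le_antisymm
  · refine openVal_le f fun a b hab => ?_
    by_cases hne : ∀ j, a j < b j
    · refine (iInf_le _ i).trans (inf_le_left.trans ((f i).above_anti ?_))
      by_contra hlt
      push Not at hlt
      obtain ⟨c, hc1, hc2⟩ := exists_between (lt_min hlt (hne i))
      obtain ⟨x, hx, hxc⟩ := box_nonempty hne i c hc1 (hc2.trans_le (min_le_right _ _))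
      have h1 : (p : ℝ) < x i := hab hx
      rw [hxc] at h1
      have h2 : p < c := by exact_mod_cast h1
      exact absurd (hc2.trans_le (min_le_left _ _)) (not_lt.2 h2.le)
    · push Not at hne
      obtain ⟨j, hj⟩ := hne
      rw [boxVal_eq_bot f hj]
      exact bot_le
  · rw [← inf_top_eq ((f i).above p), ← iSup_boxVal f one_pos, inf_iSup_eq]
    refine iSup_le fun x => ?_
    refine le_trans ?_ (le_openVal f (a := Function.update x i (max p (x i)))
      (b := fun i => x i + 1) fun z hz => ?_)
    · refine le_iInf fun j => ?_
      by_cases hj : j = i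
      · subst hj
        rw [Function.update_self, ← above_inf_above, inf_assoc]
        exact inf_le_inf_left _ (iInf_le _ j)
      · rw [Function.update_of_ne hj]
        exact inf_le_right.trans (iInf_le _ j)
    · have := (hz i).1
      rw [Function.update_self] at this
      refine lt_of_le_of_lt ?_ this
      exact_mod_cast le_max_left _ _

theorem openHom_lt (f : ι → CReal L) (i : ι) (q : ℚ) :
    openHom f (opensLt (coord i) q) = (f i).below q := by
  classical
  apply le_antisymm
  · refine openVal_le f fun a b hab => ?_
    by_cases hne : ∀ j, a j < b j
    · refine (iInf_le _ i).trans (inf_le_right.trans ((f i).below_mono ?_))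
      by_contra hlt
      push Not at hlt
      obtain ⟨c, hc1, hc2⟩ := exists_between (max_lt hlt (hne i))
      obtain ⟨x, hx, hxc⟩ := box_nonempty hne i c ((le_max_right _ _).trans_lt hc1) hc2
      have h1 : x i < (q : ℝ) := hab hx
      rw [hxc] at h1
      have h2 : c < q := by exact_mod_cast h1
      exact absurd ((le_max_left _ _).trans_lt hc1) (not_lt.2 h2.le)
    · push Not at hne
      obtain ⟨j, hj⟩ := hne
      rw [boxVal_eq_bot f hj]
      exact bot_le
  · rw [← inf_top_eq ((f i).below q), ← iSup_boxVal f one_pos, inf_iSup_eq]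
    refine iSup_le fun x => ?_
    refine le_trans ?_ (le_openVal f (a := x)
      (b := Function.update (fun i => x i + 1) i (min q (x i + 1))) fun z hz => ?_)
    · refine le_iInf fun j => ?_
      by_cases hj : j = i
      · subst hj
        rw [Function.update_self, ← below_inf_below, ← inf_assoc, inf_comm (CReal.above _ _),
          inf_assoc]
        exact inf_le_inf_left _ (iInf_le _ j)
      · rw [Function.update_of_ne hj]
        exact inf_le_right.trans (iInf_le _ j)
    · have := (hz i).2
      rw [Function.update_self] at this
      refine lt_of_lt_of_le this ?_
      exact_mod_cast min_le_left _ _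

theorem openHom_unique (f : ι → CReal L) (H : FrameHom (Opens (ι → ℝ)) L)
    (h1 : ∀ i p, H (opensGt (coord i) (p : ℚ)) = (f i).above p)
    (h2 : ∀ i q, H (opensLt (coord i) (q : ℚ)) = (f i).below q) : H = openHom f := by
  have hbox : ∀ a b : ι → ℚ, ((Finset.univ.inf fun i =>
      opensGt (coord i) (a i : ℝ) ⊓ opensLt (coord i) (b i : ℝ) : Opens (ι → ℝ)) :
      Set (ι → ℝ)) = box a b := by
    intro a b
    ext x
    simp [box, opensGt, opensLt, coord]
  have key : ∀ O : Opens (ι → ℝ), O = ⨆ a : ι → ℚ, ⨆ b : ι → ℚ,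
      ⨆ _ : box a b ⊆ (O : Set (ι → ℝ)), (Finset.univ.inf fun i =>
        opensGt (coord i) (a i : ℝ) ⊓ opensLt (coord i) (b i : ℝ) : Opens (ι → ℝ)) := by
    intro O
    apply le_antisymm
    · intro x hx
      obtain ⟨ε, hε, hball⟩ := Metric.isOpen_iff.1 O.isOpen x hx
      choose a ha1 ha2 using fun i => exists_rat_btwn (show x i - ε < x i by linarith)
      choose b hb1 hb2 using fun i => exists_rat_btwn (show x i < x i + ε by linarith)
      have hx' : x ∈ box a b := fun i => ⟨ha2 i, hb1 i⟩
      have hsub : box a b ⊆ (O : Set (ι → ℝ)) := by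
        refine subset_trans (fun z hz => ?_) hball
        rw [Metric.mem_ball, dist_pi_lt_iff hε]
        intro i
        rw [Real.dist_eq, abs_lt]
        have := hz i
        constructor <;> linarith [ha1 i, hb2 i, this.1, this.2]
      rw [← hbox] at hx'
      have hle : (Finset.univ.inf fun i =>
        opensGt (coord i) (a i : ℝ) ⊓ opensLt (coord i) (b i : ℝ) : Opens (ι → ℝ)) ≤ _ :=
        le_iSup_of_le (f := fun a : ι → ℚ => ⨆ b : ι → ℚ,
      ⨆ _ : box a b ⊆ (O : Set (ι → ℝ)), (Finset.univ.inf fun i =>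
        opensGt (coord i) (a i : ℝ) ⊓ opensLt (coord i) (b i : ℝ) : Opens (ι → ℝ)))
          a (le_iSup₂_of_le b hsub le_rfl)
      exact hle hx'
    · refine iSup_le fun a => iSup₂_le fun b hab => ?_
      rw [← hbox] at hab
      exact hab
  ext O
  rw [key O]
  simp only [map_iSup, map_finset_inf]
  refine iSup_congr fun a => iSup_congr fun b => iSup_congr fun _ => ?_
  congr 1
  funext i
  simp only [Function.comp_apply, map_inf, h1, h2, openHom_gt, openHom_lt]

/-- The continuous real function `φ(f)`. -/
noncomputable def ap (φ : C(ι → ℝ, ℝ)) (f : ι → CReal L) : CReal L :=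
  mk' (fun p => openHom f (opensGt φ p)) (fun q => openHom f (opensLt φ q))
    (by
      intro p q h
      rw [← map_inf, ← map_bot (openHom f)]
      congr 1
      ext x
      have h' : (q : ℝ) ≤ p := by exact_mod_cast h
      simpa [opensGt, opensLt] using fun h1 => h'.trans h1.le)
    (by
      intro p q h
      rw [← map_sup, ← map_top (openHom f)]
      congr 1
      ext x
      have h' : (p : ℝ) < q := by exact_mod_cast h
      simpa [opensGt, opensLt] using (lt_or_ge (p : ℝ) (φ x)).imp_right fun h1 => h1.trans_lt h')
    (by
      intro p
      simp only [← map_iSup]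
      congr 1
      ext x
      simp only [opensGt, Opens.coe_mk, Opens.coe_iSup, Set.mem_iUnion, Set.mem_ofPred_eq]
      constructor
      · intro h
        obtain ⟨r, h1, h2⟩ := exists_rat_btwn h
        exact ⟨r, by exact_mod_cast h1, h2⟩
      · rintro ⟨r, h1, h2⟩
        exact lt_trans (by exact_mod_cast h1) h2)
    (by
      intro p
      simp only [← map_iSup]
      congr 1
      ext x
      simp only [opensLt, Opens.coe_mk, Opens.coe_iSup, Set.mem_iUnion, Set.mem_ofPred_eq]
      constructor
      · intro h
        obtain ⟨r, h1, h2⟩ := exists_rat_btwn h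
        exact ⟨r, by exact_mod_cast h2, h1⟩
      · rintro ⟨r, h1, h2⟩
        exact lt_trans h2 (by exact_mod_cast h1))
    (by
      rw [← map_iSup, ← map_top (openHom f)]
      congr 1
      ext x
      simpa [opensGt] using exists_rat_lt (φ x))
    (by
      rw [← map_iSup, ← map_top (openHom f)]
      congr 1
      ext x
      simpa [opensLt] using exists_rat_gt (φ x))

theorem ap_above (φ : C(ι → ℝ, ℝ)) (f : ι → CReal L) (p : ℚ) :
    (ap φ f).above p = openHom f (opensGt φ p) := mk'_above _ _ _ _ _ _ _ _ _

theorem ap_below (φ : C(ι → ℝ, ℝ)) (f : ι → CReal L) (q : ℚ) :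
    (ap φ f).below q = openHom f (opensLt φ q) := mk'_below _ _ _ _ _ _ _ _ _

theorem ap_coord (f : ι → CReal L) (i : ι) : ap (coord i) f = f i :=
  ext (fun p => by rw [ap_above, openHom_gt]) fun q => by rw [ap_below, openHom_lt]

theorem ap_ap {κ : Type} [Fintype κ] (φ : C(κ → ℝ, ℝ)) (ψ : κ → C(ι → ℝ, ℝ)) (f : ι → CReal L) :
    ap φ (fun k => ap (ψ k) f) = ap (φ.comp (ContinuousMap.pi ψ)) f := by
  have h : (openHom f).comp (Opens.comap (ContinuousMap.pi ψ)) =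
      openHom fun k => ap (ψ k) f :=
    openHom_unique _ _ (fun k p => (ap_above _ _ _).symm) (fun k p => (ap_below _ _ _).symm)
  ext p
  · rw [ap_above, ap_above, ← h]; rfl
  · rw [ap_below, ap_below, ← h]; rfl

end Calculus

/-! #### The operations -/

noncomputable instance : Add (CReal L) := ⟨fun f g => ap (coord 0 + coord 1) ![f, g]⟩

noncomputable instance : Max (CReal L) := ⟨fun f g => ap (coord 0 ⊔ coord 1) ![f, g]⟩

noncomputable instance : Min (CReal L) := ⟨fun f g => ap (coord 0 ⊓ coord 1) ![f, g]⟩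

noncomputable instance : Neg (CReal L) := ⟨fun f => ap (-coord 0) ![f]⟩

noncomputable instance : SMul ℝ (CReal L) := ⟨fun c f => ap (c • coord 0) ![f]⟩

/-- `0(p,—)` is `1` for `p < 0` and `0` otherwise; `0(—,q)` is `1` for `q > 0` and `0` otherwise. -/
noncomputable instance : Zero (CReal L) := ⟨ap (0 : C(Fin 0 → ℝ, ℝ)) ![]⟩

section ApOps

variable {ι : Type} [Fintype ι] (φ ψ : C(ι → ℝ, ℝ)) (f : ι → CReal L)

theorem ap_vec2 (χ : C(Fin 2 → ℝ, ℝ)) :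
    ap χ ![ap φ f, ap ψ f] = ap (χ.comp (ContinuousMap.pi ![φ, ψ])) f := by
  rw [← ap_ap]
  congr 1
  funext k
  fin_cases k <;> rfl

theorem ap_vec1 (χ : C(Fin 1 → ℝ, ℝ)) :
    ap χ ![ap φ f] = ap (χ.comp (ContinuousMap.pi ![φ])) f := by
  rw [← ap_ap]
  congr 1
  funext k
  fin_cases k
  rfl

theorem ap_add : ap (φ + ψ) f = ap φ f + ap ψ f := by
  refine Eq.trans ?_ (ap_vec2 φ ψ f (coord 0 + coord 1)).symm
  congr 1

theorem ap_neg : ap (-φ) f = -ap φ f := by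
  refine Eq.trans ?_ (ap_vec1 φ f (-coord 0)).symm
  congr 1

theorem ap_smul (c : ℝ) : ap (c • φ) f = c • ap φ f := by
  refine Eq.trans ?_ (ap_vec1 φ f (c • coord 0)).symm
  congr 1

theorem ap_zero : ap (0 : C(ι → ℝ, ℝ)) f = 0 := by
  have h := ap_ap (0 : C(Fin 0 → ℝ, ℝ)) (fun i => i.elim0) f
  have h0 : (fun k : Fin 0 => ap (k.elim0 : C(ι → ℝ, ℝ)) f) = ![] := funext fun i => i.elim0
  rw [h0] at h
  exact h.symm

end ApOps

noncomputable instance : AddCommGroup (CReal L) where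
  add_assoc f g h := by
    have e := congrArg (fun φ => ap φ ![f, g, h]) (add_assoc (coord (0 : Fin 3)) (coord 1) (coord 2))
    simp only [ap_add, ap_coord] at e
    exact e
  zero_add f := by
    have e := congrArg (fun φ => ap φ ![f]) (zero_add (coord (0 : Fin 1)))
    simp only [ap_add, ap_coord, ap_zero] at e
    exact e
  add_zero f := by
    have e := congrArg (fun φ => ap φ ![f]) (add_zero (coord (0 : Fin 1)))
    simp only [ap_add, ap_coord, ap_zero] at e
    exact e
  add_comm f g := by
    have e := congrArg (fun φ => ap φ ![f, g]) (add_comm (coord (0 : Fin 2)) (coord 1))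
    simp only [ap_add, ap_coord] at e
    exact e
  neg_add_cancel f := by
    have e := congrArg (fun φ => ap φ ![f]) (neg_add_cancel (coord (0 : Fin 1)))
    simp only [ap_add, ap_coord, ap_zero, ap_neg] at e
    exact e
  nsmul := nsmulRec
  zsmul := zsmulRec

noncomputable instance : Module ℝ (CReal L) where
  one_smul f := by
    have e := congrArg (fun φ => ap φ ![f]) (one_smul ℝ (coord (0 : Fin 1)))
    simp only [ap_smul, ap_coord] at e
    exact e
  mul_smul c d f := by
    have e := congrArg (fun φ => ap φ ![f]) (mul_smul c d (coord (0 : Fin 1)))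
    simp only [ap_smul, ap_coord] at e
    exact e
  smul_zero c := by
    have e := congrArg (fun φ => ap φ (![] : Fin 0 → CReal L)) (smul_zero (A := C(Fin 0 → ℝ, ℝ)) c)
    simp only [ap_smul, ap_zero] at e
    exact e
  smul_add c f g := by
    have e := congrArg (fun φ => ap φ ![f, g]) (smul_add c (coord (0 : Fin 2)) (coord 1))
    simp only [ap_add, ap_smul, ap_coord] at e
    exact e
  add_smul c d f := by
    have e := congrArg (fun φ => ap φ ![f]) (add_smul c d (coord (0 : Fin 1)))
    simp only [ap_add, ap_smul, ap_coord] at e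
    exact e
  zero_smul f := by
    have e := congrArg (fun φ => ap φ ![f]) (zero_smul ℝ (coord (0 : Fin 1)))
    simp only [ap_smul, ap_zero, ap_coord] at e
    exact e

theorem sup_above (f g : CReal L) (p : ℚ) : (f ⊔ g).above p = f.above p ⊔ g.above p := by
  have h : opensGt (coord (0 : Fin 2) ⊔ coord 1) p =
      opensGt (coord 0) p ⊔ opensGt (coord 1) p := by
    ext x; simp [opensGt]
  refine (ap_above _ _ _).trans ?_
  rw [h, map_sup, openHom_gt, openHom_gt]
  rfl

theorem sup_below (f g : CReal L) (q : ℚ) : (f ⊔ g).below q = f.below q ⊓ g.below q := by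
  have h : opensLt (coord (0 : Fin 2) ⊔ coord 1) q =
      opensLt (coord 0) q ⊓ opensLt (coord 1) q := by
    ext x; simp [opensLt]
  refine (ap_below _ _ _).trans ?_
  rw [h, map_inf, openHom_lt, openHom_lt]
  rfl

theorem inf_above (f g : CReal L) (p : ℚ) : (f ⊓ g).above p = f.above p ⊓ g.above p := by
  have h : opensGt (coord (0 : Fin 2) ⊓ coord 1) p =
      opensGt (coord 0) p ⊓ opensGt (coord 1) p := by
    ext x; simp [opensGt]
  refine (ap_above _ _ _).trans ?_
  rw [h, map_inf, openHom_gt, openHom_gt]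
  rfl

theorem inf_below (f g : CReal L) (q : ℚ) : (f ⊓ g).below q = f.below q ⊔ g.below q := by
  have h : opensLt (coord (0 : Fin 2) ⊓ coord 1) q =
      opensLt (coord 0) q ⊔ opensLt (coord 1) q := by
    ext x; simp [opensLt]
  refine (ap_below _ _ _).trans ?_
  rw [h, map_sup, openHom_lt, openHom_lt]
  rfl

theorem add_above (f g : CReal L) (p : ℚ) :
    (f + g).above p = ⨆ r : ℚ, f.above r ⊓ g.above (p - r) := by
  have h : opensGt (coord (0 : Fin 2) + coord 1) p =
      ⨆ r : ℚ, opensGt (coord 0) r ⊓ opensGt (coord 1) ((p - r : ℚ) : ℝ) := by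
    ext x
    simp only [opensGt, coord, TopologicalSpace.Opens.coe_mk, TopologicalSpace.Opens.coe_iSup,
      TopologicalSpace.Opens.coe_inf, Set.mem_iUnion, Set.mem_inter_iff, Set.mem_ofPred_eq,
      ContinuousMap.add_apply, ContinuousMap.coe_mk, Rat.cast_sub]
    constructor
    · intro h
      obtain ⟨r, h1, h2⟩ := exists_rat_btwn (show (p : ℝ) - x 1 < x 0 by linarith)
      exact ⟨r, h2, by linarith⟩
    · rintro ⟨r, h1, h2⟩
      linarith
  refine (ap_above _ _ _).trans ?_
  rw [h, map_iSup]
  simp only [map_inf, openHom_gt]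
  rfl

theorem add_below (f g : CReal L) (q : ℚ) :
    (f + g).below q = ⨆ s : ℚ, f.below s ⊓ g.below (q - s) := by
  have h : opensLt (coord (0 : Fin 2) + coord 1) q =
      ⨆ r : ℚ, opensLt (coord 0) r ⊓ opensLt (coord 1) ((q - r : ℚ) : ℝ) := by
    ext x
    simp only [opensLt, coord, TopologicalSpace.Opens.coe_mk, TopologicalSpace.Opens.coe_iSup,
      TopologicalSpace.Opens.coe_inf, Set.mem_iUnion, Set.mem_inter_iff, Set.mem_ofPred_eq,
      ContinuousMap.add_apply, ContinuousMap.coe_mk, Rat.cast_sub]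
    constructor
    · intro h
      obtain ⟨r, h1, h2⟩ := exists_rat_btwn (show x 0 < (q : ℝ) - x 1 by linarith)
      exact ⟨r, h1, by linarith⟩
    · rintro ⟨r, h1, h2⟩
      linarith
  refine (ap_below _ _ _).trans ?_
  rw [h, map_iSup]
  simp only [map_inf, openHom_lt]
  rfl

theorem smul_above {c : ℝ} (hc : 0 < c) (f : CReal L) (p : ℚ) :
    (c • f).above p = ⨆ r : ℚ, ⨆ _ : (p : ℝ) < c * r, f.above r := by
  have h : opensGt (c • coord (0 : Fin 1)) p =
      ⨆ r : ℚ, ⨆ _ : (p : ℝ) < c * r, opensGt (coord 0) r := by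
    ext x
    simp only [opensGt, coord, TopologicalSpace.Opens.coe_mk, TopologicalSpace.Opens.coe_iSup,
      Set.mem_iUnion, Set.mem_ofPred_eq, ContinuousMap.smul_apply, ContinuousMap.coe_mk,
      smul_eq_mul, exists_prop]
    constructor
    · intro h
      obtain ⟨r, h1, h2⟩ := exists_rat_btwn (show (p : ℝ) / c < x 0 by rwa [div_lt_iff₀' hc])
      exact ⟨r, by rwa [div_lt_iff₀' hc] at h1, h2⟩
    · rintro ⟨r, h1, h2⟩
      exact h1.trans (mul_lt_mul_of_pos_left h2 hc)
  refine (ap_above _ _ _).trans ?_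
  rw [h]
  simp only [map_iSup, openHom_gt]
  rfl

theorem smul_below {c : ℝ} (hc : 0 < c) (f : CReal L) (q : ℚ) :
    (c • f).below q = ⨆ s : ℚ, ⨆ _ : c * s < (q : ℝ), f.below s := by
  have h : opensLt (c • coord (0 : Fin 1)) q =
      ⨆ r : ℚ, ⨆ _ : c * r < (q : ℝ), opensLt (coord 0) r := by
    ext x
    simp only [opensLt, coord, TopologicalSpace.Opens.coe_mk, TopologicalSpace.Opens.coe_iSup,
      Set.mem_iUnion, Set.mem_ofPred_eq, ContinuousMap.smul_apply, ContinuousMap.coe_mk,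
      smul_eq_mul, exists_prop]
    constructor
    · intro h
      obtain ⟨r, h1, h2⟩ := exists_rat_btwn (show x 0 < (q : ℝ) / c by rwa [lt_div_iff₀' hc])
      exact ⟨r, by rwa [lt_div_iff₀' hc] at h2, h1⟩
    · rintro ⟨r, h1, h2⟩
      exact lt_trans (mul_lt_mul_of_pos_left h2 hc) h1
  refine (ap_below _ _ _).trans ?_
  rw [h]
  simp only [map_iSup, openHom_lt]
  rfl

/-- The order on `C(L)` is that of `ICbar L`. -/
instance : PartialOrder (CReal L) := inferInstanceAs (PartialOrder {f : ICbar L // f.IsReal})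

theorem le_def {f g : CReal L} :
    f ≤ g ↔ (∀ p, f.above p ≤ g.above p) ∧ ∀ q, g.below q ≤ f.below q := Iff.rfl

noncomputable instance : Lattice (CReal L) where
  __ := (inferInstance : PartialOrder (CReal L))
  sup f g := f ⊔ g
  inf f g := f ⊓ g
  le_sup_left f g := le_def.2 ⟨fun p => by rw [sup_above]; exact le_sup_left,
    fun q => by rw [sup_below]; exact inf_le_left⟩
  le_sup_right f g := le_def.2 ⟨fun p => by rw [sup_above]; exact le_sup_right,
    fun q => by rw [sup_below]; exact inf_le_right⟩
  sup_le f g h h1 h2 := le_def.2 ⟨fun p => by rw [sup_above]; exact sup_le ((le_def.1 h1).1 p) ((le_def.1 h2).1 p),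
    fun q => by rw [sup_below]; exact le_inf ((le_def.1 h1).2 q) ((le_def.1 h2).2 q)⟩
  inf_le_left f g := le_def.2 ⟨fun p => by rw [inf_above]; exact inf_le_left,
    fun q => by rw [inf_below]; exact le_sup_left⟩
  inf_le_right f g := le_def.2 ⟨fun p => by rw [inf_above]; exact inf_le_right,
    fun q => by rw [inf_below]; exact le_sup_right⟩
  le_inf f g h h1 h2 := le_def.2 ⟨fun p => by rw [inf_above]; exact le_inf ((le_def.1 h1).1 p) ((le_def.1 h2).1 p),
    fun q => by rw [inf_below]; exact sup_le ((le_def.1 h1).2 q) ((le_def.1 h2).2 q)⟩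

instance : IsOrderedAddMonoid (CReal L) where
  add_le_add_left f g h k := le_def.2 ⟨fun p => by
      rw [add_above, add_above]; exact iSup_mono fun r => inf_le_inf_right _ ((le_def.1 h).1 r),
    fun q => by
      rw [add_below, add_below]; exact iSup_mono fun r => inf_le_inf_right _ ((le_def.1 h).2 r)⟩

instance : PosSMulMono ℝ (CReal L) where
  smul_le_smul_of_nonneg_left c hc f g h := by
    rcases hc.eq_or_lt with rfl | hc
    · simp only [zero_smul]; exact le_rfl
    · exact le_def.2 ⟨fun p => by
        rw [smul_above hc, smul_above hc]; exact iSup₂_mono fun r _ => (le_def.1 h).1 r,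
      fun q => by
        rw [smul_below hc, smul_below hc]; exact iSup₂_mono fun r _ => (le_def.1 h).2 r⟩

end CReal

/-! ### The Booleanization -/

/-- The Booleanization `𝔅(L) = {a ∈ L | a = a**}` is a complete Boolean algebra; its joins are the
double pseudocomplements of the joins in `L`. -/
instance {L : Type*} [Order.Frame L] : CompleteBooleanAlgebra (Heyting.Regular L) :=
  { (inferInstance : BooleanAlgebra (Heyting.Regular L)) with
    sSup := fun s => Heyting.Regular.toRegular (sSup (Heyting.Regular.val '' s))
    sInf := fun s => Heyting.Regular.toRegular (sInf (Heyting.Regular.val '' s))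
    isLUB_sSup := fun s => by
      refine ⟨fun a ha => ?_, fun b hb => ?_⟩
      · exact Heyting.Regular.coe_le_coe.1 ((le_sSup (Set.mem_image_of_mem Heyting.Regular.val ha)).trans
          le_compl_compl)
      · refine (Heyting.Regular.gi.gc _ _).2 (sSup_le ?_)
        rintro _ ⟨a, ha, rfl⟩
        exact Heyting.Regular.coe_le_coe.2 (hb ha)
    isGLB_sInf := fun s => by
      refine ⟨fun a ha => ?_, fun b hb => ?_⟩
      · exact (Heyting.Regular.gi.gc _ _).2 (sInf_le (Set.mem_image_of_mem Heyting.Regular.val ha))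
      · refine Heyting.Regular.coe_le_coe.1 (le_trans (le_sInf ?_) le_compl_compl)
        rintro _ ⟨a, ha, rfl⟩
        exact Heyting.Regular.coe_le_coe.2 (hb ha) }

theorem regular_coe_sSup {L : Type*} [Order.Frame L] (s : Set (Heyting.Regular L)) :
    ((sSup s : Heyting.Regular L) : L) = (sSup (Heyting.Regular.val '' s))ᶜᶜ := rfl

theorem regular_coe_iSup {L : Type*} [Order.Frame L] {κ : Sort*} (s : κ → Heyting.Regular L) :
    ((⨆ i, s i : Heyting.Regular L) : L) = (⨆ i, (s i : L))ᶜᶜ := by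
  rw [iSup, regular_coe_sSup, ← Set.range_comp]
  rfl

/-- The frame homomorphism `a ↦ a**` from `L` to its Booleanization. -/
def beta (L : Type*) [Order.Frame L] : FrameHom L (Heyting.Regular L) where
  toFun a := Heyting.Regular.toRegular a
  map_inf' a b := Heyting.Regular.coe_injective (compl_compl_inf_distrib a b)
  map_top' := Heyting.Regular.coe_injective (show (⊤ : L)ᶜᶜ = ⊤ by simp)
  map_sSup' s := by
    rw [sSup_image]
    exact Heyting.Regular.gi.gc.l_sSup

theorem coe_beta {L : Type*} [Order.Frame L] (a : L) : ((beta L a : Heyting.Regular L) : L) = aᶜᶜ :=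
  rfl

theorem beta_coe {L : Type*} [Order.Frame L] (a : Heyting.Regular L) : beta L (a : L) = a :=
  Heyting.Regular.toRegular_coe a

section Gamma

variable {L : Type*} [Order.Frame L]

theorem compl_le_of_sup_eq_top {a b : L} (h : a ⊔ b = ⊤) : aᶜ ≤ b := by
  calc aᶜ = aᶜ ⊓ (a ⊔ b) := by rw [h, inf_top_eq]
    _ = aᶜ ⊓ b := by rw [inf_sup_left, compl_inf_self, bot_sup_eq]
    _ ≤ b := inf_le_right

namespace ICbar

theorem IsHausdorff.postcomp_beta {f : ICbar L} (hf : f.IsHausdorff) :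
    (postcomp (beta L) f).IsExtReal := by
  intro p q h
  rw [postcomp_above, postcomp_below, ← map_sup]
  apply Heyting.Regular.coe_injective
  rw [coe_beta, Heyting.Regular.coe_top, eq_top_iff]
  have h1 : (f.above p ⊔ f.below q)ᶜ ≤ ⊥ := by
    rw [compl_sup]
    calc (f.above p)ᶜ ⊓ (f.below q)ᶜ ≤ f.below q ⊓ (f.below q)ᶜ :=
          inf_le_inf_right _ (hf p q h).1
      _ = ⊥ := inf_compl_self _
  rw [le_bot_iff.1 h1, compl_bot]

/-- `Δ(g)(p,—) = ⋁_{r > p} g(r,—)` and `Δ(g)(—,q) = ⋁_{s < q} g(—,s)`, the joins taken in `L`. -/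
noncomputable def delta (g : ICbar (Heyting.Regular L)) : ICbar L :=
  mk' (fun p => ⨆ r : ℚ, ⨆ _ : p < r, (g.above r : L))
    (fun q => ⨆ s : ℚ, ⨆ _ : s < q, (g.below s : L))
    (by
      intro p q h
      simp only [iSup_inf_eq, inf_iSup_eq]
      refine le_bot_iff.1 (iSup₂_le fun r hr => iSup₂_le fun s hs => ?_)
      have hsr : g.above s ⊓ g.below r = ⊥ := g.above_inf_below (by linarith)
      rw [← Heyting.Regular.coe_inf, hsr, Heyting.Regular.coe_bot])
    (by
      intro p
      apply le_antisymm
      · refine iSup₂_le fun r hr => ?_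
        obtain ⟨t, ht, ht'⟩ := exists_between hr
        exact le_iSup₂_of_le t ht (le_iSup₂_of_le r ht' le_rfl)
      · exact iSup₂_le fun t ht => iSup₂_le fun r hr => le_iSup₂_of_le r (ht.trans hr) le_rfl)
    (by
      intro q
      apply le_antisymm
      · refine iSup₂_le fun s hs => ?_
        obtain ⟨t, ht, ht'⟩ := exists_between hs
        exact le_iSup₂_of_le t ht' (le_iSup₂_of_le s ht le_rfl)
      · exact iSup₂_le fun t ht => iSup₂_le fun r hr => le_iSup₂_of_le r (hr.trans ht) le_rfl)

theorem delta_above (g : ICbar (Heyting.Regular L)) (p : ℚ) :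
    (delta g).above p = ⨆ r : ℚ, ⨆ _ : p < r, (g.above r : L) := mk'_above _ _ _ _ _ _

theorem delta_below (g : ICbar (Heyting.Regular L)) (q : ℚ) :
    (delta g).below q = ⨆ s : ℚ, ⨆ _ : s < q, (g.below s : L) := mk'_below _ _ _ _ _ _

theorem postcomp_beta_delta (g : ICbar (Heyting.Regular L)) : postcomp (beta L) (delta g) = g := by
  ext p
  · rw [postcomp_above, delta_above, map_iSup, g.above_eq]
    simp only [map_iSup, beta_coe]
  · rw [postcomp_below, delta_below, map_iSup, g.below_eq]
    simp only [map_iSup, beta_coe]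

theorem delta_isHausdorff {g : ICbar (Heyting.Regular L)} (hg : g.IsExtReal) :
    (delta g).IsHausdorff := by
  have ha : ∀ p, ((delta g).above p)ᶜ = ((g.above p)ᶜ : Heyting.Regular L) := fun p => by
    rw [← postcomp_beta_delta g, postcomp_above, Heyting.Regular.coe_compl, coe_beta,
      postcomp_beta_delta, compl_compl_compl]
  have hb : ∀ q, ((delta g).below q)ᶜ = ((g.below q)ᶜ : Heyting.Regular L) := fun q => by
    rw [← postcomp_beta_delta g, postcomp_below, Heyting.Regular.coe_compl, coe_beta,
      postcomp_beta_delta, compl_compl_compl]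
  intro p q h
  obtain ⟨t, ht, ht'⟩ := exists_between h
  constructor
  · rw [ha, delta_below]
    exact le_iSup₂_of_le t ht' (Heyting.Regular.coe_le_coe.2
      (compl_le_of_sup_eq_top (hg p t ht)))
  · rw [hb, delta_above]
    exact le_iSup₂_of_le t ht (Heyting.Regular.coe_le_coe.2
      (compl_le_of_sup_eq_top ((sup_comm _ _).trans (hg t q ht'))))

theorem delta_postcomp_beta {f : ICbar L} (hf : f.IsHausdorff) :
    delta (postcomp (beta L) f) = f := by
  ext p
  · rw [delta_above]
    apply le_antisymm
    · refine iSup₂_le fun r hr => ?_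
      rw [postcomp_above, coe_beta]
      refine le_trans (compl_anti ?_) (hf p r hr).2
      exact le_compl_iff_disjoint_left.2 (disjoint_iff.2 (f.above_inf_below le_rfl))
    · rw [f.above_eq]
      exact iSup₂_mono fun r _ => le_compl_compl
  · rw [delta_below]
    apply le_antisymm
    · refine iSup₂_le fun r hr => ?_
      rw [postcomp_below, coe_beta]
      refine le_trans (compl_anti ?_) (hf r p hr).1
      exact le_compl_iff_disjoint_right.2 (disjoint_iff.2 (f.above_inf_below le_rfl))
    · rw [f.below_eq]
      exact iSup₂_mono fun r _ => le_compl_compl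

theorem isNearlyFinite_iff (f : ICbar L) :
    f.IsNearlyFinite ↔ (⨆ p : ℚ, (postcomp (beta L) f).above p) = ⊤ ∧
      (⨆ q : ℚ, (postcomp (beta L) f).below q) = ⊤ := by
  have h : ∀ a : L, beta L a = ⊤ ↔ aᶜ = ⊥ := fun a => by
    rw [← Heyting.Regular.coe_inj, coe_beta, Heyting.Regular.coe_top]
    constructor
    · intro h
      rw [← compl_compl_compl a, h, compl_top]
    · intro h
      rw [h, compl_bot]
  simp only [postcomp_above, postcomp_below, ← map_iSup, h, IsNearlyFinite]

theorem IsReal.isHausdorff {f : ICbar L} (hf : f.IsReal) : f.IsHausdorff := by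
  intro p q h
  have := hf.1 p q h
  exact ⟨compl_le_of_sup_eq_top this, compl_le_of_sup_eq_top ((sup_comm _ _).trans this)⟩

theorem IsReal.isNearlyFinite {f : ICbar L} (hf : f.IsReal) : f.IsNearlyFinite := by
  rw [IsNearlyFinite, hf.2.1, hf.2.2, compl_top]
  exact ⟨rfl, rfl⟩

end ICbar

namespace Hnf

/-- The order on `H_nf(L)` is that of `ICbar L`. -/
instance : PartialOrder (Hnf L) :=
  inferInstanceAs (PartialOrder {f : ICbar L // f.IsHausdorff ∧ f.IsNearlyFinite})

/-- A continuous real function is a nearly finite Hausdorff continuous function. -/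
def ofReal (f : CReal L) : Hnf L := ⟨f.1, f.2.isHausdorff, f.2.isNearlyFinite⟩

/-- The order isomorphism `f ↦ β · f` of `H_nf(L)` with `C(𝔅(L))`; its inverse is `Δ`. -/
noncomputable def gamma : Hnf L ≃o CReal (Heyting.Regular L) where
  toFun f := ⟨ICbar.postcomp (beta L) f.1, f.2.1.postcomp_beta, f.1.isNearlyFinite_iff.1 f.2.2⟩
  invFun g := ⟨ICbar.delta g.1, ICbar.delta_isHausdorff g.2.1, by
    rw [ICbar.isNearlyFinite_iff, ICbar.postcomp_beta_delta]; exact g.2.2⟩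
  left_inv f := Subtype.ext (ICbar.delta_postcomp_beta f.2.1)
  right_inv g := Subtype.ext (ICbar.postcomp_beta_delta g.1)
  map_rel_iff' := by
    rintro ⟨f, hf⟩ ⟨g, hg⟩
    change ICbar.postcomp (beta L) f ≤ ICbar.postcomp (beta L) g ↔ f ≤ g
    constructor
    · intro h
      rw [← ICbar.delta_postcomp_beta hf.1, ← ICbar.delta_postcomp_beta hg.1, ICbar.le_def]
      simp only [ICbar.delta_above, ICbar.delta_below]
      exact ⟨fun p => iSup₂_mono fun r _ => h.1 r, fun q => iSup₂_mono fun s _ => h.2 s⟩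
    · exact fun h => ⟨fun p => OrderHomClass.mono (beta L) (h.1 p),
        fun q => OrderHomClass.mono (beta L) (h.2 q)⟩

/-! The operations of `H_nf(L)` are those of `C(𝔅(L))`: `f ⊕ g = Δ(Γ(f) + Γ(g))`,
`λ ⊙ f = Δ(λ Γ(f))` and so on. -/

noncomputable instance : AddCommGroup (Hnf L) := (gamma (L := L)).toEquiv.addCommGroup

noncomputable instance : Module ℝ (Hnf L) := (gamma (L := L)).toEquiv.module ℝ

theorem gamma_add (f g : Hnf L) : gamma (f + g) = gamma f + gamma g :=
  gamma.apply_symm_apply _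

theorem gamma_smul (c : ℝ) (f : Hnf L) : gamma (c • f) = c • gamma f :=
  gamma.apply_symm_apply _

noncomputable instance : Lattice (Hnf L) where
  __ := (inferInstance : PartialOrder (Hnf L))
  sup f g := gamma.symm (gamma f ⊔ gamma g)
  inf f g := gamma.symm (gamma f ⊓ gamma g)
  le_sup_left f g := by
    rw [gamma.le_symm_apply]; exact le_sup_left
  le_sup_right f g := by
    rw [gamma.le_symm_apply]; exact le_sup_right
  sup_le f g h h1 h2 := by
    rw [gamma.symm_apply_le]; exact sup_le (gamma.monotone h1) (gamma.monotone h2)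
  inf_le_left f g := by
    rw [gamma.symm_apply_le]; exact inf_le_left
  inf_le_right f g := by
    rw [gamma.symm_apply_le]; exact inf_le_right
  le_inf f g h h1 h2 := by
    rw [gamma.le_symm_apply]; exact le_inf (gamma.monotone h1) (gamma.monotone h2)

instance : IsOrderedAddMonoid (Hnf L) where
  add_le_add_left f g h k := by
    rw [← gamma.le_iff_le, gamma_add, gamma_add]
    exact add_le_add_left (gamma.monotone h) _

instance : PosSMulMono ℝ (Hnf L) where
  smul_le_smul_of_nonneg_left c hc f g h := by
    rw [← gamma.le_iff_le, gamma_smul, gamma_smul]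
    exact smul_le_smul_of_nonneg_left (gamma.monotone h) hc

end Hnf

end Gamma

/-! ### Completely regular frames and universal completions -/

/-- `b` is rather below `a`: `b* ∨ a = 1`. -/
def RatherBelow {L : Type*} [Order.Frame L] (b a : L) : Prop := bᶜ ⊔ a = ⊤

/-- `b` is completely below `a`: there are `c r` for rational `r` in `[0,1]` with `b ≤ c 0`,
`c 1 ≤ a` and `c r ≺ c s` whenever `r < s`. -/
def CompletelyBelow {L : Type*} [Order.Frame L] (b a : L) : Prop :=
  ∃ c : Set.Icc (0 : ℚ) 1 → L, b ≤ c 0 ∧ c 1 ≤ a ∧ ∀ r s, r < s → RatherBelow (c r) (c s)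

/-- Every `a` is the join of the elements that are completely below `a`. -/
def IsCompletelyRegularFrame (L : Type*) [Order.Frame L] : Prop :=
  ∀ a : L, a = sSup {b | CompletelyBelow b a}

/-- Every non-empty subset that is bounded above has a supremum. -/
def IsDedekindComplete (R : Type*) [Lattice R] : Prop :=
  ∀ A : Set R, A.Nonempty → BddAbove A → ∃ s, IsLUB A s

/-- Every non-empty set of positive, pairwise disjoint elements has a supremum. -/
def IsLaterallyComplete (R : Type*) [Lattice R] [Zero R] : Prop :=
  ∀ A : Set R, A.Nonempty → (∀ f ∈ A, 0 ≤ f) → (∀ f ∈ A, ∀ g ∈ A, f ≠ g → f ⊓ g = 0) →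
    ∃ s, IsLUB A s

/-- Dedekind complete and laterally complete. -/
def IsUniversallyComplete (R : Type*) [Lattice R] [Zero R] : Prop :=
  IsDedekindComplete R ∧ IsLaterallyComplete R

/-- `μ : R → U` is an injective linear lattice homomorphism of Riesz spaces. -/
structure IsRieszEmbedding {R U : Type*}
    [Lattice R] [AddCommGroup R] [IsOrderedAddMonoid R] [Module ℝ R] [PosSMulMono ℝ R]
    [Lattice U] [AddCommGroup U] [IsOrderedAddMonoid U] [Module ℝ U] [PosSMulMono ℝ U]
    (μ : R → U) : Prop where
  map_add : ∀ f g, μ (f + g) = μ f + μ g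
  map_smul : ∀ (c : ℝ) f, μ (c • f) = c • μ f
  map_sup : ∀ f g, μ (f ⊔ g) = μ f ⊔ μ g
  map_inf : ∀ f g, μ (f ⊓ g) = μ f ⊓ μ g
  injective : Function.Injective μ

/-- `(U, μ)` is the universal completion of the Riesz space `R`. -/
structure IsUniversalCompletion {R U : Type*}
    [Lattice R] [AddCommGroup R] [IsOrderedAddMonoid R] [Module ℝ R] [PosSMulMono ℝ R]
    [Lattice U] [AddCommGroup U] [IsOrderedAddMonoid U] [Module ℝ U] [PosSMulMono ℝ U]
    (μ : R → U) : Prop where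
  isRieszEmbedding : IsRieszEmbedding μ
  isUniversallyComplete : IsUniversallyComplete U
  isLUB : ∀ f : U, 0 ≤ f → IsLUB {x | ∃ g : R, x = μ g ∧ 0 ≤ μ g ∧ μ g ≤ f} f

end Pointfree

/-! A Hausdorff continuous `f` can be recovered from `β · f`. For `r > p`, (r1) and Hausdorff
continuity give `f(r,—)** ≤ f(—,r)* ≤ f(p,—)`, so the join of the `f(r,—)**` over `r > p` is
`f(p,—)`, and likewise for `(—,q)`. Hence `Δ` inverts `Γ`; both maps are monotone. Since `β(a) = 1`
exactly when `a* = 0`, nearly finite functions correspond to those with (r5) and (r6). The Riesz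
structure on `Hnf L` is transported along this bijection.

Universal completeness is therefore a statement about `C(B)` for a complete Boolean algebra `B`.
There an antitone family is automatically a scale, because `a* ∨ a = 1`. The pointwise join `d(p)`
of the `f(p,—)`, for `f` in a non-empty set, thus defines the supremum as soon as `⋀_p d(p) = 0`
(`CReal.exists_isLUB_of_iInf`). An upper bound forces this meet to vanish; so does pairwise
disjointness, since on `f(0,—)` only the member `f` contributes to `d(p)` for `p ≥ 0`.

The inclusion of `C(L)`, followed by `Γ`, is composition with `β`. Composition with any frame
homomorphism respects the operations, because a homomorphism on the opens of `ℝ^ι` is determined by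
its values on coordinate half spaces (`CReal.postcomp_ap`).

Order density is a Urysohn argument. Complete regularity writes `f(r,—)` as a join of elements `b`
completely below it, and `CReal.exists_separating` gives a continuous `g` of height `r` that is full
on `b` and lives on `f(r,—)`, so `0 ≤ g ≤ f`. Any upper bound of such `g` lies above `b` at every
level `p < r`. Comparing the generators `(p,—)` suffices, because Hausdorff continuity determines
the `(—,q)` from them. -/

namespace Pointfree

variable {L : Type*} [Order.Frame L]

/-! ### The order of Hausdorff continuous functions -/

namespace ICbar

/-- By (r1), `f(—,s)` is disjoint from `f(s,—)`, which with (r4) gives one inequality; the other is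
half of Hausdorff continuity. The lower generators are thus redundant. -/
theorem IsHausdorff.below_eq_iSup_compl {f : ICbar L} (hf : f.IsHausdorff) (q : ℚ) :
    f.below q = ⨆ s : ℚ, ⨆ _ : s < q, (f.above s)ᶜ := by
  apply le_antisymm
  · rw [f.below_eq]
    exact iSup₂_mono fun s _ =>
      le_compl_iff_disjoint_left.2 (disjoint_iff.2 (f.above_inf_below le_rfl))
  · exact iSup₂_le fun s hs => (hf s q hs).1

/-- The order between Hausdorff continuous functions is determined by the generators `(p,—)`. -/
theorem IsHausdorff.le_iff {f g : ICbar L} (hf : f.IsHausdorff) (hg : g.IsHausdorff) :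
    f ≤ g ↔ ∀ p, f.above p ≤ g.above p := by
  refine ⟨fun h => h.1, fun h => ⟨h, fun q => ?_⟩⟩
  rw [hf.below_eq_iSup_compl, hg.below_eq_iSup_compl]
  exact iSup₂_mono fun s _ => compl_anti (h s)

end ICbar

theorem RatherBelow.le {a b : L} (h : RatherBelow b a) : b ≤ a :=
  le_compl_compl.trans (compl_le_of_sup_eq_top h)

/-! ### Continuous real functions and composition with frame homomorphisms -/

namespace CReal

theorem le_iff_above {f g : CReal L} : f ≤ g ↔ ∀ p, f.above p ≤ g.above p :=
  ICbar.IsHausdorff.le_iff f.2.isHausdorff g.2.isHausdorff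

/-- Meeting with the cover of (r6) and distributing, the term at `q` is killed by (r1) with `p = q`.
Suprema inherit finiteness from their bounds in this form. -/
theorem iInf_above (f : CReal L) : (⨅ p : ℚ, f.above p) = ⊥ := by
  rw [← inf_top_eq (⨅ p : ℚ, f.above p), ← f.iSup_below, inf_iSup_eq, eq_bot_iff]
  exact iSup_le fun q => (inf_le_inf_right _ (iInf_le _ q)).trans (f.above_inf_below le_rfl).le

/-- Zero is the constant function on the one-point space `ℝ^0`, where a half space is everything or
empty. -/
theorem zero_above (p : ℚ) [Decidable (p < 0)] :
    (0 : CReal L).above p = if p < 0 then ⊤ else ⊥ := by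
  refine (ap_above _ _ _).trans ?_
  split_ifs with h
  · rw [← map_top (openHom (![] : Fin 0 → CReal L))]
    congr 1
    ext x
    simpa [opensGt] using h
  · rw [← map_bot (openHom (![] : Fin 0 → CReal L))]
    congr 1
    ext x
    simpa [opensGt] using h

/-- The composite with a frame homomorphism. -/
def postcomp {M : Type*} [Order.Frame M] (h : FrameHom L M) (f : CReal L) : CReal M :=
  ⟨ICbar.postcomp h f.1, by
    refine ⟨fun p q hpq => ?_, ?_, ?_⟩
    · rw [ICbar.postcomp_above, ICbar.postcomp_below, ← map_sup, f.2.1 p q hpq, map_top]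
    · simp only [ICbar.postcomp_above, ← map_iSup, f.2.2.1, map_top]
    · simp only [ICbar.postcomp_below, ← map_iSup, f.2.2.2, map_top]⟩

/-- The composite of `h` with `openHom f` takes the values of the `h · f i` on the coordinate half
spaces, so `openHom_unique` identifies it. This handles all operations at once. -/
theorem postcomp_ap {M : Type*} [Order.Frame M] (h : FrameHom L M) {ι : Type} [Fintype ι]
    (φ : C(ι → ℝ, ℝ)) (f : ι → CReal L) :
    postcomp h (ap φ f) = ap φ fun i => postcomp h (f i) := by
  have e : h.comp (openHom f) = openHom fun i => postcomp h (f i) :=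
    openHom_unique _ _ (fun i p => congrArg h (openHom_gt f i p))
      fun i q => congrArg h (openHom_lt f i q)
  ext p
  · rw [ap_above, ← e]
    exact congrArg h (ap_above φ f p)
  · rw [ap_below, ← e]
    exact congrArg h (ap_below φ f p)

section Postcomp

variable {M : Type*} [Order.Frame M] (h : FrameHom L M)

theorem postcomp_ap_one (φ : C(Fin 1 → ℝ, ℝ)) (f : CReal L) :
    postcomp h (ap φ ![f]) = ap φ ![postcomp h f] := by
  rw [postcomp_ap]
  congr 1
  funext i
  fin_cases i
  rfl

theorem postcomp_ap_two (φ : C(Fin 2 → ℝ, ℝ)) (f g : CReal L) :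
    postcomp h (ap φ ![f, g]) = ap φ ![postcomp h f, postcomp h g] := by
  rw [postcomp_ap]
  congr 1
  funext i
  fin_cases i <;> rfl

theorem postcomp_add (f g : CReal L) : postcomp h (f + g) = postcomp h f + postcomp h g :=
  postcomp_ap_two h _ f g

theorem postcomp_sup (f g : CReal L) : postcomp h (f ⊔ g) = postcomp h f ⊔ postcomp h g :=
  postcomp_ap_two h _ f g

theorem postcomp_inf (f g : CReal L) : postcomp h (f ⊓ g) = postcomp h f ⊓ postcomp h g :=
  postcomp_ap_two h _ f g

theorem postcomp_smul (c : ℝ) (f : CReal L) : postcomp h (c • f) = c • postcomp h f :=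
  postcomp_ap_one h _ f

end Postcomp

/-! ### Scales and separating functions -/

/-- The continuous real function determined by a scale, that is, a map `d` such that `d t` is
rather below `d s` for `s < t`. -/
noncomputable def ofScale (d : ℚ → L) (hd : ∀ s t, s < t → RatherBelow (d t) (d s))
    (h5 : (⨆ t, d t) = ⊤) (h6 : (⨆ t, (d t)ᶜ) = ⊤) : CReal L :=
  mk' (fun p => ⨆ t : ℚ, ⨆ _ : p < t, d t) (fun q => ⨆ s : ℚ, ⨆ _ : s < q, (d s)ᶜ)
    (by
      intro p q h
      simp only [iSup_inf_eq, inf_iSup_eq, ← le_bot_iff]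
      refine iSup₂_le fun t ht => iSup₂_le fun s hs => ?_
      refine (inf_le_inf (hd _ _ ?_).le le_rfl).trans (inf_compl_self _).le
      linarith)
    (by
      intro p q h
      -- With `p < s < t < q`, the element `d s` lies under the value at `(p,—)` and `(d t)ᶜ` under
      -- the value at `(—,q)`; the scale condition says that these two cover.
      obtain ⟨s, hs, hs'⟩ := exists_between h
      obtain ⟨t, ht, ht'⟩ := exists_between hs'
      rw [eq_top_iff, ← hd s t ht, sup_comm]
      exact sup_le_sup (le_iSup₂_of_le s hs le_rfl) (le_iSup₂_of_le t ht' le_rfl))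
    (by
      intro p
      apply le_antisymm
      · refine iSup₂_le fun t ht => ?_
        obtain ⟨r, hr, hr'⟩ := exists_between ht
        exact le_iSup₂_of_le r hr (le_iSup₂_of_le t hr' le_rfl)
      · exact iSup₂_le fun r hr => iSup₂_le fun t ht => le_iSup₂_of_le t (hr.trans ht) le_rfl)
    (by
      intro q
      apply le_antisymm
      · refine iSup₂_le fun t ht => ?_
        obtain ⟨r, hr, hr'⟩ := exists_between ht
        exact le_iSup₂_of_le r hr' (le_iSup₂_of_le t hr le_rfl)
      · exact iSup₂_le fun r hr => iSup₂_le fun t ht => le_iSup₂_of_le t (ht.trans hr) le_rfl)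
    (by
      rw [eq_top_iff, ← h5]
      exact iSup_le fun t => le_iSup_of_le (t - 1) (le_iSup₂_of_le t (by linarith) le_rfl))
    (by
      rw [eq_top_iff, ← h6]
      exact iSup_le fun t => le_iSup_of_le (t + 1) (le_iSup₂_of_le t (by linarith) le_rfl))

theorem ofScale_above (d : ℚ → L) (hd h5 h6) (p : ℚ) :
    (ofScale d hd h5 h6).above p = ⨆ t : ℚ, ⨆ _ : p < t, d t := mk'_above _ _ _ _ _ _ _ _ _

/-- Completely below elements are separated by a continuous real function with values between
`0` and `r`. -/
theorem exists_separating {a b : L} (hba : CompletelyBelow b a) {r : ℚ} (hr : 0 < r) :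
    ∃ g : CReal L, (∀ p < 0, g.above p = ⊤) ∧ (∀ p < r, b ≤ g.above p) ∧
      (∀ p, 0 ≤ p → p < r → g.above p ≤ a) ∧ ∀ p, r ≤ p → g.above p = ⊥ := by
  obtain ⟨c, hb, ha, hc⟩ := hba
  have hmem : ∀ t : ℚ, 0 ≤ t ∧ t ≤ r → 1 - t / r ∈ Set.Icc (0 : ℚ) 1 := fun t ht =>
    ⟨by have := (div_le_one hr).2 ht.2; linarith, by have := div_nonneg ht.1 hr.le; linarith⟩
  have hmono : Monotone c := fun x y h => by
    rcases h.eq_or_lt with rfl | h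
    · exact le_rfl
    · exact (hc x y h).le
  -- A scale decreases while `c` increases, so the interpolation is reversed and stretched over `[0,
  -- r]`: the value at `t = 0` is `c 1 ≤ a` and at `t = r` it is `c 0 ≥ b`. Outside, `⊤` and `⊥`
  -- keep the function between `0` and `r`.
  let d : ℚ → L := fun t =>
    if t < 0 then ⊤ else if h : 0 ≤ t ∧ t ≤ r then c ⟨1 - t / r, hmem t h⟩ else ⊥
  have d_neg : ∀ t < 0, d t = ⊤ := fun t ht => if_pos ht
  have d_mid : ∀ t (h : 0 ≤ t ∧ t ≤ r), d t = c ⟨1 - t / r, hmem t h⟩ := fun t h => by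
    simp only [d, if_neg (not_lt.2 h.1), dif_pos h]
  have d_gt : ∀ t, r < t → d t = ⊥ := fun t h => by
    simp only [d, if_neg (not_lt.2 (hr.trans h).le), dif_neg (mt And.right (not_le.2 h))]
  have hd : ∀ s t, s < t → RatherBelow (d t) (d s) := by
    intro s t hst
    unfold RatherBelow
    rcases lt_or_ge s 0 with hs | hs
    · rw [d_neg s hs, sup_top_eq]
    rcases lt_or_ge r t with ht | ht
    · rw [d_gt t ht, compl_bot, top_sup_eq]
    rw [d_mid s ⟨hs, hst.le.trans ht⟩, d_mid t ⟨hs.trans hst.le, ht⟩]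
    refine hc _ _ ?_
    have := div_lt_div_of_pos_right hst hr
    exact Subtype.mk_lt_mk.2 (by linarith)
  refine ⟨ofScale d hd ?_ ?_, fun p hp => ?_, fun p hp => ?_, fun p hp hpr => ?_, fun p hp => ?_⟩
  · exact top_le_iff.1 (le_iSup_of_le (-1) (d_neg _ (by norm_num)).ge)
  · exact top_le_iff.1 (le_iSup_of_le (r + 1) (by rw [d_gt _ (by linarith), compl_bot]))
  · rw [ofScale_above]
    exact top_le_iff.1 (le_iSup₂_of_le (p / 2) (by linarith) (d_neg _ (by linarith)).ge)
  · rw [ofScale_above]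
    -- The maximum with `0` places `t` in the interpolation range even for negative `p`.
    obtain ⟨t, ht, htr⟩ := exists_between (max_lt hp hr)
    have ht0 := (le_max_right p 0).trans ht.le
    refine le_iSup₂_of_le t ((le_max_left _ _).trans_lt ht) ?_
    rw [d_mid t ⟨ht0, htr.le⟩]
    exact hb.trans (hmono (hmem t ⟨ht0, htr.le⟩).1)
  · rw [ofScale_above]
    refine iSup₂_le fun t ht => ?_
    rcases lt_or_ge r t with h | h
    · rw [d_gt t h]
      exact bot_le
    · rw [d_mid t ⟨hp.trans ht.le, h⟩]
      exact (hmono (hmem t ⟨hp.trans ht.le, h⟩).2).trans ha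
  · rw [ofScale_above, ← le_bot_iff]
    exact iSup₂_le fun t ht => (d_gt t (hp.trans_lt ht)).le

/-! ### Suprema over a complete Boolean algebra -/

section Complete

variable {B : Type*} [CompleteBooleanAlgebra B]

/-- Over a complete Boolean algebra, a non-empty set of continuous real functions has a supremum
as soon as its pointwise supremum is finite. -/
theorem exists_isLUB_of_iInf {A : Set (CReal B)} (hne : A.Nonempty)
    (h : (⨅ p : ℚ, ⨆ f ∈ A, f.above p) = ⊥) : ∃ s, IsLUB A s := by
  set d : ℚ → B := fun p => ⨆ f ∈ A, f.above p
  have hanti : Antitone d := fun p q hpq => iSup₂_mono fun f _ => f.above_anti hpq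
  -- Joins commute, so `d` inherits (r3), and the function built from the scale `d` takes exactly
  -- the value `d p` at `(p,—)`.
  have habove : ∀ p, (⨆ t : ℚ, ⨆ _ : p < t, d t) = d p := fun p => by
    apply le_antisymm
    · exact iSup₂_le fun t ht => hanti ht.le
    · refine iSup₂_le fun f hf => ?_
      rw [f.above_eq]
      exact iSup₂_mono fun t _ => le_iSup₂_of_le f hf le_rfl
  -- In a Boolean algebra every element is rather below itself, so being antitone is enough.
  have hscale : ∀ s t, s < t → RatherBelow (d t) (d s) := fun s t hst =>
    top_le_iff.1 (compl_sup_eq_top.ge.trans (sup_le_sup_left (hanti hst.le) _))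
  -- A single member of `A` already gives (r5).
  have h5 : (⨆ t, d t) = ⊤ := by
    obtain ⟨f, hf⟩ := hne
    rw [eq_top_iff, ← f.iSup_above]
    exact iSup_mono fun p => le_iSup₂_of_le f hf le_rfl
  -- De Morgan's law turns the vanishing meet into (r6).
  have h6 : (⨆ t, (d t)ᶜ) = ⊤ := by rw [← compl_iInf, h, compl_bot]
  refine ⟨ofScale d hscale h5 h6, fun f hf => ?_, fun g hg => ?_⟩
  · refine le_iff_above.2 fun p => ?_
    rw [ofScale_above, habove]
    exact le_iSup₂_of_le f hf le_rfl
  · refine le_iff_above.2 fun p => ?_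
    rw [ofScale_above, habove]
    exact iSup₂_le fun f hf => le_iff_above.1 (hg hf) p

/-- The pointwise supremum stays below `g(p,—)` for an upper bound `g`, and these have meet `0`. -/
theorem isDedekindComplete : IsDedekindComplete (CReal B) := by
  rintro A hne ⟨g, hg⟩
  refine exists_isLUB_of_iInf hne (le_bot_iff.1 ?_)
  rw [← g.iInf_above]
  exact iInf_mono fun p => iSup₂_le fun f hf => le_iff_above.1 (hg hf) p

/-- Disjoint members have disjoint elements `f(0,—)`. On each of these pieces the pointwise supremum
agrees with one finite function at non-negative levels, so the meet over all levels vanishes there;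
and that meet lies under the join of the pieces. -/
theorem isLaterallyComplete : IsLaterallyComplete (CReal B) := by
  classical
  intro A hne _ hdisj
  refine exists_isLUB_of_iInf hne (le_bot_iff.1 ?_)
  have h0 : ∀ f ∈ A, ∀ g ∈ A, f ≠ g → f.above 0 ⊓ g.above 0 = ⊥ := fun f hf g hg hfg => by
    rw [← inf_above, hdisj f hf g hg hfg, zero_above, if_neg (lt_irrefl _)]
  have key : ∀ f ∈ A, (⨅ p : ℚ, ⨆ g ∈ A, g.above p) ⊓ f.above 0 ≤ ⊥ := fun f hf => by
    rw [← f.iInf_above]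
    refine le_iInf fun p => ?_
    -- The level `max p 0` serves both cases: being at least `p`, it bounds the term of `f` itself
    -- by `f(p,—)`; being at least `0`, it makes the other terms disjoint from `f(0,—)`.
    refine (inf_le_inf_right _ (iInf_le _ (max p 0))).trans ?_
    simp only [iSup_inf_eq]
    refine iSup₂_le fun g hg => ?_
    by_cases hfg : f = g
    · subst hfg
      exact inf_le_left.trans (f.above_anti (le_max_left _ _))
    · refine (inf_le_inf_right _ (g.above_anti (le_max_right _ _))).trans ?_
      rw [h0 g hg f hf (Ne.symm hfg)]
      exact bot_le
  calc (⨅ p : ℚ, ⨆ f ∈ A, f.above p)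
      ≤ (⨅ p : ℚ, ⨆ f ∈ A, f.above p) ⊓ ⨆ f ∈ A, f.above 0 := le_inf le_rfl (iInf_le _ 0)
    _ ≤ ⊥ := by
      simp only [inf_iSup_eq]
      exact iSup₂_le key

end Complete

end CReal

/-! ### Hausdorff continuous functions and the Booleanization -/

/-- The order isomorphism `f ↦ β · f` of the Hausdorff continuous functions with the extended
continuous functions on the Booleanization; its inverse is `Δ`. -/
noncomputable def Hbar.gamma : Hbar L ≃o Cbar (Heyting.Regular L) where
  toFun f := ⟨ICbar.postcomp (beta L) f.1, f.2.postcomp_beta⟩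
  invFun g := ⟨ICbar.delta g.1, ICbar.delta_isHausdorff g.2⟩
  left_inv f := Subtype.ext (ICbar.delta_postcomp_beta f.2)
  right_inv g := Subtype.ext (ICbar.postcomp_beta_delta g.1)
  map_rel_iff' := by
    rintro ⟨f, hf⟩ ⟨g, hg⟩
    change ICbar.postcomp (beta L) f ≤ ICbar.postcomp (beta L) g ↔ f ≤ g
    constructor
    · intro h
      -- The order is reflected because `f` and `g` are images under `Δ`, which is monotone by its
      -- formula.
      rw [← ICbar.delta_postcomp_beta hf, ← ICbar.delta_postcomp_beta hg, ICbar.le_def]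
      simp only [ICbar.delta_above, ICbar.delta_below]
      exact ⟨fun p => iSup₂_mono fun r _ => h.1 r, fun q => iSup₂_mono fun s _ => h.2 s⟩
    · exact fun h => ⟨fun p => OrderHomClass.mono (beta L) (h.1 p),
        fun q => OrderHomClass.mono (beta L) (h.2 q)⟩

namespace Hnf

theorem le_iff_above {f g : Hnf L} : f ≤ g ↔ ∀ p, f.1.above p ≤ g.1.above p :=
  ICbar.IsHausdorff.le_iff f.2.1 g.2.1

theorem gamma_zero : gamma (0 : Hnf L) = 0 := gamma.apply_symm_apply _

theorem gamma_sup (f g : Hnf L) : gamma (f ⊔ g) = gamma f ⊔ gamma g :=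
  gamma.apply_symm_apply _

theorem gamma_inf (f g : Hnf L) : gamma (f ⊓ g) = gamma f ⊓ gamma g :=
  gamma.apply_symm_apply _

/-- `f ↦ β · f` as a linear isomorphism of `H_nf(L)` with `C(𝔅(L))`. -/
noncomputable def gammaLinearEquiv : Hnf L ≃ₗ[ℝ] CReal (Heyting.Regular L) where
  __ := (gamma (L := L)).toEquiv
  map_add' := gamma_add
  map_smul' := gamma_smul

theorem exists_isLUB_of_gamma {A : Set (Hnf L)} (h : ∃ s, IsLUB (gamma '' A) s) :
    ∃ s, IsLUB A s := by
  obtain ⟨s, hs⟩ := h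
  refine ⟨gamma.symm s, ?_⟩
  rwa [← OrderIso.isLUB_image]

theorem isDedekindComplete : IsDedekindComplete (Hnf L) := fun _ hne hbdd =>
  exists_isLUB_of_gamma
    (CReal.isDedekindComplete _ (hne.image _) (gamma.monotone.map_bddAbove hbdd))

theorem isLaterallyComplete : IsLaterallyComplete (Hnf L) := by
  intro A hne hpos hdisj
  refine exists_isLUB_of_gamma (CReal.isLaterallyComplete _ (hne.image _) ?_ ?_)
  · rintro _ ⟨f, hf, rfl⟩
    rw [← gamma_zero]
    exact gamma.monotone (hpos f hf)
  · rintro _ ⟨f, hf, rfl⟩ _ ⟨g, hg, rfl⟩ hfg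
    rw [← gamma_inf, hdisj f hf g hg fun h => hfg (congrArg _ h), gamma_zero]

/-! ### The embedding of `C(L)` and its order density -/

theorem isRieszEmbedding_ofReal : IsRieszEmbedding (ofReal : CReal L → Hnf L) where
  map_add f g := gamma.injective <| by
    rw [gamma_add]
    exact CReal.postcomp_add _ f g
  map_smul c f := gamma.injective <| by
    rw [gamma_smul]
    exact CReal.postcomp_smul _ c f
  map_sup f g := gamma.injective <| by
    rw [gamma_sup]
    exact CReal.postcomp_sup _ f g
  map_inf f g := gamma.injective <| by
    rw [gamma_inf]
    exact CReal.postcomp_inf _ f g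
  injective _ _ h := Subtype.ext (congrArg (fun k : Hnf L => k.1) h)

/-- The zero of `Hnf L` is transported through `Δ`; additivity of the embedding identifies it with
the constant zero of `C(L)`, whose values are known. -/
theorem ofReal_zero : ofReal (0 : CReal L) = 0 := by
  have h := isRieszEmbedding_ofReal.map_add (0 : CReal L) 0
  rwa [add_zero, left_eq_add] at h

theorem nonneg_iff {f : Hnf L} : 0 ≤ f ↔ ∀ p < 0, f.1.above p = ⊤ := by
  classical
  have h0 : ∀ p : ℚ, (0 : Hnf L).1.above p = if p < 0 then ⊤ else ⊥ := fun p => by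
    rw [← ofReal_zero]
    exact CReal.zero_above p
  rw [le_iff_above]
  refine ⟨fun h p hp => ?_, fun h p => ?_⟩
  · simpa [h0, hp] using h p
  · rw [h0]
    split_ifs with hp
    · exact (h p hp).ge
    · exact bot_le

/-- Over a completely regular frame, every positive nearly finite Hausdorff continuous function is
the supremum of the positive continuous real functions below it. -/
theorem isLUB_ofReal (hL : IsCompletelyRegularFrame L) {f : Hnf L} (hf : 0 ≤ f) :
    IsLUB {x | ∃ g : CReal L, x = ofReal g ∧ 0 ≤ ofReal g ∧ ofReal g ≤ f} f := by
  refine ⟨?_, fun h hh => ?_⟩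
  · rintro _ ⟨g, rfl, -, hg⟩
    exact hg
  refine le_iff_above.2 fun p => ?_
  rcases lt_or_ge p 0 with hp | hp
  -- Zero is itself one of the approximants, which settles the negative levels.
  · have h0 : 0 ≤ h := hh ⟨0, ofReal_zero.symm, ofReal_zero.ge, ofReal_zero.trans_le hf⟩
    rw [nonneg_iff.1 h0 p hp]
    exact le_top
  -- Passing to `r > p` leaves room: a function of height `r` on `b` exceeds the level `p` there,
  -- and `r > 0`.
  rw [f.1.above_eq]
  refine iSup₂_le fun r hr => ?_
  rw [hL (f.1.above r)]
  refine sSup_le fun b hb => ?_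
  obtain ⟨g, hneg, hbg, hga, hgr⟩ := CReal.exists_separating hb (hp.trans_lt hr)
  -- It suffices that `0 ≤ g ≤ f`. At negative levels `f` is already `⊤`; at `0 ≤ q < r` the value
  -- of `g` is under `f(r,—) ≤ f(q,—)`; from `r` on it is `⊥`.
  have hgh : ofReal g ≤ h := by
    refine hh ⟨g, rfl, nonneg_iff.2 hneg, le_iff_above.2 fun q => ?_⟩
    change g.above q ≤ f.1.above q
    rcases lt_or_ge q 0 with hq | hq
    · rw [nonneg_iff.1 hf q hq]
      exact le_top
    rcases lt_or_ge q r with hqr | hqr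
    · exact (hga q hq hqr).trans (f.1.above_anti hqr.le)
    · rw [hgr q hqr]
      exact bot_le
  exact (hbg p hr).trans (le_iff_above.1 hgh p)

theorem isUniversalCompletion_ofReal (hL : IsCompletelyRegularFrame L) :
    IsUniversalCompletion (ofReal : CReal L → Hnf L) where
  isRieszEmbedding := isRieszEmbedding_ofReal
  isUniversallyComplete := ⟨isDedekindComplete, isLaterallyComplete⟩
  isLUB _ := isLUB_ofReal hL

end Hnf

end Pointfree

theorem mainTheorem2 {L : Type*} [Order.Frame L] (hL : Pointfree.IsCompletelyRegularFrame L) :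
    Pointfree.IsUniversalCompletion (Pointfree.Hnf.ofReal : Pointfree.CReal L → Pointfree.Hnf L) ∧
    ∃ Γ : Pointfree.Hbar L ≃o Pointfree.Cbar (Heyting.Regular L),
      (∀ f : Pointfree.Hbar L, (Γ f).1 = Pointfree.ICbar.postcomp (Pointfree.beta L) f.1) ∧
      (∀ (g : Pointfree.Cbar (Heyting.Regular L)) (p : ℚ),
        (Γ.symm g).1.above p = ⨆ r : ℚ, ⨆ _ : p < r, (g.1.above r : L)) ∧
      (∀ (g : Pointfree.Cbar (Heyting.Regular L)) (q : ℚ),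
        (Γ.symm g).1.below q = ⨆ s : ℚ, ⨆ _ : s < q, (g.1.below s : L)) ∧
      (∀ f : Pointfree.Hbar L, f.1.IsNearlyFinite ↔ (Γ f).1.IsReal) ∧
      ∃ Γ' : Pointfree.Hnf L ≃ₗ[ℝ] Pointfree.CReal (Heyting.Regular L),
        (∀ f g : Pointfree.Hnf L, Γ' (f ⊔ g) = Γ' f ⊔ Γ' g) ∧
        (∀ f g : Pointfree.Hnf L, Γ' (f ⊓ g) = Γ' f ⊓ Γ' g) ∧
        ∀ f : Pointfree.Hnf L, (Γ' f).1 = (Γ ⟨f.1, f.2.1⟩).1 := by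
  refine ⟨Pointfree.Hnf.isUniversalCompletion_ofReal hL, Pointfree.Hbar.gamma, fun _ => rfl,
    fun g p => Pointfree.ICbar.delta_above g.1 p, fun g q => Pointfree.ICbar.delta_below g.1 q,
    fun f => ?_, Pointfree.Hnf.gammaLinearEquiv, Pointfree.Hnf.gamma_sup,
    Pointfree.Hnf.gamma_inf, fun _ => rfl⟩
  -- Near finiteness amounts to (r5) and (r6) for `β · f`; (r2) comes from Hausdorff continuity.
  exact f.1.isNearlyFinite_iff.trans (and_iff_right f.2.postcomp_beta).symm
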